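/- Let $n\ge 1$ be an integer and let $a>-1$, $b>-n$ be real numbers. Write $\langle z,w\rangle=\sum_{j=1}^n z_j\overline{w_j}$ and $|z|=\sqrt{\langle z,z\rangle}$ on $\mathbb C^n$, and let $\mathbb B_n=\{z\in\mathbb C^n:|z|<1\}$. Let $\mu_{a,b}$ be the probability measure on $\mathbb B_n$ given by $$d\mu_{a,b}(z)=\frac{(n-1)!}{\pi^n\,\beta(a+1,b+n)}\,|z|^{2b}(1-|z|^2)^a\,d\lambda_n(z),$$ where $\lambda_n$ is Lebesgue measure on $\mathbb C^n$ and $\beta(s,t)=\Gamma(s)\Gamma(t)/\Gamma(s+t)$. For $|\xi|<1$ put $$\mathcal K_{a,b}(\xi)={}_2F_1\left(\begin{matrix} n,\ a+b+n+1\\ b+n\end{matrix}\,\middle|\,\xi\right)=\sum_{k\ge 0}\frac{(n)_k\,(a+b+n+1)_k}{(b+n)_k}\,\frac{\xi^k}{k!}.$$ For $f\in L^1(\mathbb B_n,d\mu_{a,b})$ and $z\in\mathbb B_n$, the Berezin transform of $f$ is $$\mathbf B_{a,b}f(z)=\int_{\mathbb B_n}f(w)\,\frac{|\mathcal K_{a,b}(\langle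 w,z\rangle)|^2}{\mathcal K_{a,b}(|z|^2)}\,d\mu_{a,b}(w).$$ For a complex-valued $f\in L^2(\mathbb B_n,d\mu_{a,b})$, put $$MO(f)(z)=\left(\mathbf B_{a,b}(|f|^2)(z)-|\mathbf B_{a,b}f(z)|^2\right)^{1/2}\qquad(z\in\mathbb B_n),$$ and say that $f\in BMO$ if $\|f\|_{BMO}:=\sup_{z\in\mathbb B_n}MO(f)(z)<+\infty$. Let $\psi_{a,b}(z)=\log\mathcal K_{a,b}(|z|^2)$, let $A(z)$ be its complex Hessian on $\mathbb B_n$, and write $$\langle A(z)\xi,\xi\rangle=\sum_{j,k=1}^n\frac{\partial^2\psi_{a,b}}{\partial z_j\,\partial\overline z_k}(z)\,\xi_j\overline{\xi_k}\qquad(z\in\mathbb B_n,\ \xi\in\mathbb C^n).$$ For $z,w\in\mathbb B_n$, let $\mathbf d_{a,b}(z,w)$ be the infimum of the lengths $$\ell_{a,b}(\gamma)=\int_0^1\langle A(\gamma(t))\gamma'(t),\gamma'(t)\rangle^{1/2}\,dt$$ over all piecewise smooth curves $\gamma:[0,1]\to\mathbb B_n$ with $\gamma(0)=z$ and $\gamma(1)=w$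 (continuous curves that are $C^\infty$ on each closed interval of a finite partition of $[0,1]$). Theorem. For every $f\in BMO$ and all $z,w\in\mathbb B_n$, $$|\mathbf B_{a,b}f(z)-\mathbf B_{a,b}f(w)|\le 2\,\|f\|_{BMO}\,\mathbf d_{a,b}(z,w).$$ -/

import Mathlib

open MeasureTheory Set
open scoped ContDiff ComplexConjugate

noncomputable section

namespace BergmanBall

/-- Complex Euclidean space `ℂⁿ`, with the norm `|z| = (∑ |z_j|²)^(1/2)`. -/
abbrev Cn (n : ℕ) : Type := EuclideanSpace ℂ (Fin n)

/-- The open unit ball of `ℂⁿ`. -/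
abbrev unitBall (n : ℕ) : Set (Cn n) := Metric.ball (0 : Cn n) 1

/-- The Hermitian product `⟨z, w⟩ = ∑ z_j conj(w_j)`, linear in the first variable. -/
def herm {n : ℕ} (z w : Cn n) : ℂ := ∑ j, z j * conj (w j)

/-- The probability measure
`dμ_{a,b}(z) = (n-1)! / (π^n β(a+1, b+n)) |z|^(2b) (1-|z|²)^a dλ_n(z)` on the unit ball,
extended by zero to `ℂⁿ`. -/
def mu (n : ℕ) (a b : ℝ) : Measure (Cn n) :=
  ((volume : Measure (Cn n)).restrict (unitBall n)).withDensity fun z =>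
    ENNReal.ofReal
      (((n - 1).factorial : ℝ) / (Real.pi ^ n * ProbabilityTheory.beta (a + 1) (b + n)) *
        ‖z‖ ^ (2 * b) * (1 - ‖z‖ ^ 2) ^ a)

/-- The hypergeometric function `𝒦_{a,b}(ξ) = ₂F₁(n, a+b+n+1; b+n; ξ)`, for `ξ` in the unit disc
of `𝔸 = ℂ` or in the interval `(-1, 1)` of `𝔸 = ℝ`. -/
def calK {𝔸 : Type} [NormedRing 𝔸] [NormedAlgebra ℝ 𝔸] (n : ℕ) (a b : ℝ) (ξ : 𝔸) : 𝔸 :=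
  ordinaryHypergeometric (n : ℝ) (a + b + n + 1) (b + n) ξ

/-- The Berezin transform
`𝐁_{a,b} f (z) = ∫ f(w) |𝒦_{a,b}(⟨w,z⟩)|² / 𝒦_{a,b}(|z|²) dμ_{a,b}(w)`
of a real or complex valued function. -/
def berezin {𝕂 : Type} [NormedAddCommGroup 𝕂] [NormedSpace ℝ 𝕂] (n : ℕ) (a b : ℝ)
    (f : Cn n → 𝕂) (z : Cn n) : 𝕂 :=
  ∫ w, (‖calK n a b (herm w z)‖ ^ 2 / calK n a b (‖z‖ ^ 2)) • f w ∂(mu n a b)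

/-- The mean oscillation `MO(f)(z) = (𝐁(|f|²)(z) - |𝐁f(z)|²)^(1/2)`. -/
def meanOsc (n : ℕ) (a b : ℝ) (f : Cn n → ℂ) (z : Cn n) : ℝ :=
  Real.sqrt (berezin n a b (fun w => ‖f w‖ ^ 2) z - ‖berezin n a b f z‖ ^ 2)

/-- `f ∈ BMO`: `f ∈ L²(𝔹_n, dμ_{a,b})` and its mean oscillation is bounded on the ball. -/
structure IsBMO (n : ℕ) (a b : ℝ) (f : Cn n → ℂ) : Prop where
  memLp : MemLp f 2 (mu n a b)
  bddAbove : BddAbove (meanOsc n a b f '' unitBall n)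

/-- `‖f‖_BMO = sup_{z ∈ 𝔹_n} MO(f)(z)`. -/
def bmoNorm (n : ℕ) (a b : ℝ) (f : Cn n → ℂ) : ℝ :=
  sSup (meanOsc n a b f '' unitBall n)

/-- The Wirtinger derivative `∂g/∂z_j = (1/2) (∂g/∂x_j - i ∂g/∂y_j)`. -/
def dz {n : ℕ} (j : Fin n) (g : Cn n → ℂ) (z : Cn n) : ℂ :=
  (1 / 2 : ℂ) * (fderiv ℝ g z (EuclideanSpace.single j 1)
    - Complex.I * fderiv ℝ g z (EuclideanSpace.single j Complex.I))

/-- The Wirtinger derivative `∂g/∂z̄_k = (1/2) (∂g/∂x_k + i ∂g/∂y_k)`. -/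
def dzbar {n : ℕ} (k : Fin n) (g : Cn n → ℂ) (z : Cn n) : ℂ :=
  (1 / 2 : ℂ) * (fderiv ℝ g z (EuclideanSpace.single k 1)
    + Complex.I * fderiv ℝ g z (EuclideanSpace.single k Complex.I))

/-- The potential `ψ_{a,b}(z) = log 𝒦_{a,b}(|z|²)`. -/
def psi (n : ℕ) (a b : ℝ) (z : Cn n) : ℝ := Real.log (calK n a b (‖z‖ ^ 2))

/-- The complex Hessian `A(z)`, with entries `∂²ψ_{a,b} / ∂z_j ∂z̄_k (z)`. -/
def hess (n : ℕ) (a b : ℝ) (z : Cn n) : Matrix (Fin n) (Fin n) ℂ :=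
  Matrix.of fun j k => dz j (dzbar k fun w => (psi n a b w : ℂ)) z

/-- The (real) value of the Hermitian form
`⟨A(z)ξ, ξ⟩ = ∑_{j,k} ∂²ψ_{a,b} / ∂z_j ∂z̄_k (z) ξ_j conj(ξ_k)`. -/
def hessForm (n : ℕ) (a b : ℝ) (z ξ : Cn n) : ℝ :=
  (∑ j, ∑ k, hess n a b z j k * ξ j * conj (ξ k)).re

/-- `γ` restricts to a piecewise smooth curve `[0,1] → 𝔹_n` from `z` to `w`: it is continuous on
`[0,1]` and smooth on each closed interval of some partition `0 = t_0 < t_1 < ⋯ < t_m = 1`. -/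
structure IsPiecewiseSmoothCurve {n : ℕ} (z w : Cn n) (γ : ℝ → Cn n) : Prop where
  continuousOn : ContinuousOn γ (Icc 0 1)
  piecewise : ∃ (m : ℕ) (t : ℕ → ℝ), t 0 = 0 ∧ t m = 1 ∧ (∀ i < m, t i < t (i + 1)) ∧
    ∀ i < m, ContDiffOn ℝ ∞ γ (Icc (t i) (t (i + 1)))
  mem_ball : ∀ s ∈ Icc (0 : ℝ) 1, γ s ∈ unitBall n
  source : γ 0 = z
  target : γ 1 = w

/-- The length `ℓ_{a,b}(γ) = ∫_0^1 ⟨A(γ(t))γ'(t), γ'(t)⟩^(1/2) dt`. -/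
def curveLength (n : ℕ) (a b : ℝ) (γ : ℝ → Cn n) : ℝ :=
  ∫ t in (0 : ℝ)..1, Real.sqrt (hessForm n a b (γ t) (deriv γ t))

/-- The Bergman-Poincaré distance `𝐝_{a,b}(z,w)`: the infimum of the lengths of the piecewise
smooth curves in the ball from `z` to `w`. -/
def bpDist (n : ℕ) (a b : ℝ) (z w : Cn n) : ℝ :=
  sInf (curveLength n a b '' {γ | IsPiecewiseSmoothCurve z w γ})

end BergmanBall

end

/-! Fix `z`, put `u(w) = 𝒦(⟨w,z⟩)` and `N = 𝒦(|z|²)`. The functions `u` are reproducing kernels in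
`L²(μ)` (`integral_calK_mul_conj_calK`), so `‖u‖² = N`. Hence `|u|²/N` is a probability density, the
Berezin transform `c` of `f` at `z` is the mean of `f` for it, and `MO(f)(z)²` is the variance.

The metric also lives in `L²(μ)`. If `u'` is the derivative of the kernel as `z` moves with velocity
`v`, and `e` is the component of `u'` orthogonal to `u`, then `‖e‖² = N ⟨A(z)v,v⟩`
(`integral_norm_sq_deriv_calK_sub`). This is the usual formula for the complex Hessian of `log
‖u‖²`.

Along a curve the quotient rule gives the derivative `(1/N) ∫ (e ū + u ē)(f - c) dμ`: the component
of `u'` along `u` drops out because `f - c` has mean zero for `|u|²/N`. By Cauchy-Schwarz it is at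
most `(2/N) ‖e‖ ‖u (f - c)‖ = 2 MO(f)(z) ⟨A(z)v,v⟩^(1/2)` (`exists_hasDerivAt_berezin`). Integrating
over each smooth piece, summing, and taking the infimum over curves proves the theorem.

The reproducing property rests on the moments of linear functionals under `μ`, which are reciprocals
of the Taylor coefficients of `𝒦` (`integral_norm_herm_pow_mu`). They come from Gaussian moments by
comparison in polar coordinates; mixed moments vanish by unitary invariance. -/

namespace BergmanBall

/-! ### Polar coordinates and Gaussian moments of linear functionals -/

section Polar

open Module

variable {E : Type*} [NormedAddCommGroup E] [NormedSpace ℝ E] [MeasurableSpace E] [BorelSpace E]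
  [FiniteDimensional ℝ E] [Nontrivial E]

/-- Integration in polar coordinates of a homogeneous function times a radial function. -/
theorem integral_homogeneous_mul_fun_norm (μ : Measure E) [μ.IsAddHaarMeasure] (p : E → ℝ) (m : ℕ)
    (hp : ∀ r : ℝ, 0 < r → ∀ x, p (r • x) = r ^ m * p x) (g : ℝ → ℝ) :
    ∫ x, p x * g ‖x‖ ∂μ = (∫ s : Metric.sphere (0 : E) 1, p s ∂μ.toSphere) *
      ∫ r in Ioi (0 : ℝ), r ^ (finrank ℝ E - 1) * (r ^ m * g r) := by
  have hrad : ∫ r : Ioi (0 : ℝ), ((r : ℝ) ^ m * g r) ∂Measure.volumeIoiPow (finrank ℝ E - 1) =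
      ∫ r in Ioi (0 : ℝ), r ^ (finrank ℝ E - 1) * (r ^ m * g r) := by
    simp only [Measure.volumeIoiPow, ENNReal.ofReal]
    rw [integral_withDensity_eq_integral_smul,
      integral_subtype_comap measurableSet_Ioi
        fun r : ℝ ↦ Real.toNNReal (r ^ (finrank ℝ E - 1)) • (r ^ m * g r),
      setIntegral_congr_fun measurableSet_Ioi fun x hx ↦ ?_]
    · rw [NNReal.smul_def, Real.coe_toNNReal _ (pow_nonneg hx.out.le _), smul_eq_mul]
    · exact (measurable_subtype_coe.pow_const _).real_toNNReal
  calc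
    ∫ x, p x * g ‖x‖ ∂μ = ∫ x : ({(0)}ᶜ : Set E), p x.1 * g ‖x.1‖ ∂(μ.comap (↑)) := by
      rw [integral_subtype_comap (measurableSet_singleton _).compl fun x ↦ p x * g ‖x‖,
        restrict_compl_singleton]
    _ = ∫ x, p x.1 * ((x.2 : ℝ) ^ m * g x.2)
          ∂μ.toSphere.prod (.volumeIoiPow (finrank ℝ E - 1)) := by
      rw [← μ.measurePreserving_homeomorphUnitSphereProd.integral_comp
        (Homeomorph.measurableEmbedding _)]
      refine integral_congr_ae (.of_forall fun x ↦ ?_)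
      have hx : 0 < ‖x.1‖ := norm_pos_iff.2 x.2
      -- Homogeneity at the unit vector: `p x = ‖x‖ ^ m * p (x / ‖x‖)`, which separates the
      -- variables.
      have h := hp ‖x.1‖ hx (‖x.1‖⁻¹ • x.1)
      rw [smul_inv_smul₀ hx.ne'] at h
      simp only [homeomorphUnitSphereProd_apply_snd_coe, homeomorphUnitSphereProd_apply_fst_coe]
      rw [h]
      ring
    _ = _ := by
      rw [integral_prod_mul (fun s : Metric.sphere (0 : E) 1 ↦ p s)
        (fun r : Ioi (0 : ℝ) ↦ (r : ℝ) ^ m * g r), hrad]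

end Polar

theorem herm_eq_inner {n : ℕ} (z w : Cn n) : herm z w = inner ℂ w z := by
  simp [herm, PiLp.inner_apply]

theorem finrank_real_Cn (n : ℕ) : Module.finrank ℝ (Cn n) = 2 * n := by
  rw [← Module.finrank_mul_finrank ℝ ℂ (Cn n)]
  simp

theorem integral_complex_gaussian_pow (k : ℕ) :
    ∫ x : ℂ, ‖x‖ ^ (2 * k) * Real.exp (-‖x‖ ^ 2) = Real.pi * k.factorial := by
  have h := Complex.integral_rpow_mul_exp_neg_rpow (p := 2) (q := (2 * k : ℕ)) (by norm_num)
    (by have := Nat.cast_nonneg (α := ℝ) (2 * k); linarith)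
  have h2 : (((2 * k : ℕ) : ℝ) + 2) / 2 = k + 1 := by push_cast; ring
  rw [h2, Real.Gamma_nat_eq_factorial] at h
  rw [mul_div_cancel_left₀ _ (two_ne_zero' ℝ)] at h
  rw [← h]
  refine integral_congr_ae (.of_forall fun x ↦ ?_)
  simp only [Real.rpow_natCast, Real.rpow_two]

theorem integral_pi_gaussian_coord {n : ℕ} (i : Fin n) (k : ℕ) :
    ∫ w : Fin n → ℂ, ‖w i‖ ^ (2 * k) * Real.exp (-∑ j, ‖w j‖ ^ 2) =
      Real.pi ^ n * k.factorial := by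
  have h := integral_fintype_prod_volume_eq_prod (𝕜 := ℝ) (E := fun _ : Fin n ↦ ℂ)
    (fun j x ↦ ‖x‖ ^ (2 * if j = i then k else 0) * Real.exp (-‖x‖ ^ 2))
  simp only [integral_complex_gaussian_pow, Finset.prod_mul_distrib] at h
  have e1 : ∀ w : Fin n → ℂ, (∏ j, ‖w j‖ ^ (2 * if j = i then k else 0)) = ‖w i‖ ^ (2 * k) := by
    intro w
    rw [Finset.prod_eq_single i]
    · simp
    · intro j _ hj; simp [hj]
    · simp
  have e2 : (∏ j : Fin n, (((if j = i then k else 0).factorial : ℕ) : ℝ)) = k.factorial := by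
    rw [Finset.prod_eq_single i]
    · simp
    · intro j _ hj; simp [hj]
    · simp
  simp only [e1, e2, ← Real.exp_sum, Finset.sum_neg_distrib, Finset.prod_const, Finset.card_univ,
    Fintype.card_fin] at h
  exact h

/-- The Gaussian moments of a coordinate function on `ℂⁿ`. -/
theorem integral_gaussian_coord {n : ℕ} (i : Fin n) (k : ℕ) :
    ∫ w : Cn n, ‖w i‖ ^ (2 * k) * Real.exp (-‖w‖ ^ 2) = Real.pi ^ n * k.factorial := by
  let e : (Fin n → ℂ) ≃L[ℝ] Cn n :=
    (PiLp.continuousLinearEquiv 2 ℝ (fun _ : Fin n ↦ ℂ)).symm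
  -- Fubini computes moments for the transported product measure `ν`. By uniqueness of Haar measure
  -- the volume is `c • ν`, and the total Gaussian mass, known for both, forces `c = 1`.
  let ν : Measure (Cn n) := Measure.map e volume
  have hν : ν.IsAddHaarMeasure := e.isAddHaarMeasure_map volume
  have hint : ∀ m : ℕ, ∫ w : Cn n, ‖w i‖ ^ (2 * m) * Real.exp (-‖w‖ ^ 2) ∂ν =
      Real.pi ^ n * m.factorial := by
    intro m
    have hme : MeasurableEmbedding e := e.toHomeomorph.measurableEmbedding
    rw [hme.integral_map, ← integral_pi_gaussian_coord i m]
    refine integral_congr_ae (.of_forall fun x ↦ ?_)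
    have : ‖e x‖ ^ 2 = ∑ j, ‖x j‖ ^ 2 := EuclideanSpace.norm_sq_eq _
    simp only [this]
    rfl
  have hvol := Measure.isAddLeftInvariant_eq_smul (volume : Measure (Cn n)) ν
  set c := Measure.addHaarScalarFactor (volume : Measure (Cn n)) ν with hc
  have h0 : ∫ w : Cn n, Real.exp (-‖w‖ ^ 2) = Real.pi ^ n := by
    have := GaussianFourier.integral_rexp_neg_mul_sq_norm (V := Cn n) one_pos
    simp only [neg_mul, one_mul, div_one, finrank_real_Cn] at this
    rw [this]
    push_cast
    rw [mul_div_cancel_left₀ _ (two_ne_zero' ℝ), Real.rpow_natCast]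
  have h1 := hint 0
  simp only [mul_zero, pow_zero, one_mul, Nat.factorial_zero, Nat.cast_one, mul_one] at h1
  have hc1 : (c : ℝ) = 1 := by
    rw [hvol, integral_smul_nnreal_measure, h1, NNReal.smul_def, smul_eq_mul] at h0
    have : Real.pi ^ n ≠ 0 := by positivity
    field_simp at h0
    exact h0
  rw [hvol, integral_smul_nnreal_measure, hint, NNReal.smul_def, hc1, one_smul]

/-- A unitary change of variables taking a given vector to a multiple of a coordinate vector. -/
theorem exists_isometry_herm {n : ℕ} (hn : 1 ≤ n) (z : Cn n) :
    ∃ (U : Cn n ≃ₗᵢ[ℂ] Cn n) (i : Fin n), ∀ w, ‖herm w z‖ = ‖z‖ * ‖U w i‖ := by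
  let i : Fin n := ⟨0, hn⟩
  rcases eq_or_ne z 0 with rfl | hz
  · exact ⟨LinearIsometryEquiv.refl ℂ _, i, fun w ↦ by simp [herm_eq_inner]⟩
  · have hz' : (‖z‖ : ℂ) ≠ 0 := by simpa using hz
    let v : Fin n → Cn n := fun _ ↦ (‖z‖⁻¹ : ℂ) • z
    have hv : Orthonormal ℂ (({i} : Set (Fin n)).domRestrict v) := by
      refine ⟨fun j ↦ ?_, fun j k hjk ↦ absurd (Subsingleton.elim j k) hjk⟩
      simp [v, norm_smul, hz]
    obtain ⟨B, hB⟩ := hv.exists_orthonormalBasis_extension_of_card_eq (by simp)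
    refine ⟨B.repr, i, fun w ↦ ?_⟩
    rw [B.repr_apply_apply, hB i rfl, herm_eq_inner, inner_smul_left]
    simp [hz]

/-- The Gaussian moments of a linear functional on `ℂⁿ`. -/
theorem integral_gaussian_herm {n : ℕ} (hn : 1 ≤ n) (z : Cn n) (k : ℕ) :
    ∫ w : Cn n, ‖herm w z‖ ^ (2 * k) * Real.exp (-‖w‖ ^ 2) =
      Real.pi ^ n * k.factorial * ‖z‖ ^ (2 * k) := by
  obtain ⟨U, i, hU⟩ := exists_isometry_herm hn z
  let U' : Cn n ≃ₗᵢ[ℝ] Cn n :=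
    { toLinearEquiv := U.toLinearEquiv.restrictScalars ℝ, norm_map' := U.norm_map }
  have hmp : MeasurePreserving U' := U'.measurePreserving
  have h := hmp.integral_comp U'.toHomeomorph.measurableEmbedding
    (fun w : Cn n ↦ ‖w i‖ ^ (2 * k) * Real.exp (-‖w‖ ^ 2))
  rw [integral_gaussian_coord] at h
  rw [← h, ← integral_mul_const]
  refine integral_congr_ae (.of_forall fun w ↦ ?_)
  have h1 : U' w = U w := rfl
  simp only [hU, h1, U.norm_map]
  ring

/-! ### Radial integrals and the moments of `mu` -/

theorem eval_ascPochhammer_mul_Gamma {x : ℝ} (hx : 0 < x) (k : ℕ) :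
    (ascPochhammer ℝ k).eval x * Real.Gamma x = Real.Gamma (x + k) := by
  induction k with
  | zero => simp
  | succ k ih =>
    have h : x + k ≠ 0 := by positivity
    rw [ascPochhammer_succ_eval, Nat.cast_succ, ← add_assoc, Real.Gamma_add_one h, ← ih]
    ring

/-- This is the total mass one of the beta distribution, cleared of its normalising constant. -/
theorem integral_Ioo_eq_beta {α β : ℝ} (hα : 0 < α) (hβ : 0 < β) :
    ∫ x in Ioo (0 : ℝ) 1, x ^ (α - 1) * (1 - x) ^ (β - 1) = ProbabilityTheory.beta α β := by
  have hB := ProbabilityTheory.beta_pos hα hβ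
  have h := ProbabilityTheory.lintegral_betaPDF_eq_one hα hβ
  rw [ProbabilityTheory.lintegral_betaPDF, ← ENNReal.toReal_eq_one_iff,
    ← integral_eq_lintegral_of_nonneg_ae] at h
  · simp_rw [mul_assoc, integral_const_mul] at h
    field_simp at h
    exact h
  · refine ae_restrict_of_forall_mem measurableSet_Ioo fun x hx ↦ ?_
    have h1 : 0 < 1 - x := sub_pos.2 hx.2
    have h0 : 0 < x := hx.1
    simp only [Pi.zero_apply]
    positivity
  · exact Measurable.aestronglyMeasurable (by fun_prop)

/-- The radial profile `r^(2b) (1-r²)^a` of the weight, extended by zero to `r ≥ 1`. -/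
noncomputable def radialWeight (a b r : ℝ) : ℝ := if r < 1 then r ^ (2 * b) * (1 - r ^ 2) ^ a else 0

theorem radialWeight_nonneg (a b : ℝ) {r : ℝ} (hr : 0 ≤ r) : 0 ≤ radialWeight a b r := by
  unfold radialWeight
  split_ifs with h
  · have : 0 ≤ 1 - r ^ 2 := by nlinarith
    positivity
  · exact le_rfl

theorem measurable_radialWeight (a b : ℝ) : Measurable (radialWeight a b) :=
  Measurable.ite measurableSet_Iio (by fun_prop) measurable_const

theorem integral_Ioi_gaussian_radial {n : ℕ} (hn : 1 ≤ n) (k : ℕ) :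
    ∫ r in Ioi (0 : ℝ), r ^ (2 * n - 1) * (r ^ (2 * k) * Real.exp (-r ^ 2)) =
      Real.Gamma (n + k) / 2 := by
  have hq : (-1 : ℝ) < ((2 * n - 1 + 2 * k : ℕ) : ℝ) := by
    have := Nat.cast_nonneg (α := ℝ) (2 * n - 1 + 2 * k); linarith
  have h := integral_rpow_mul_exp_neg_rpow (p := 2) two_pos hq
  have e : (((2 * n - 1 + 2 * k : ℕ) : ℝ) + 1) / 2 = n + k := by
    have : 2 * n - 1 + 2 * k + 1 = 2 * (n + k) := by omega
    rw [← Nat.cast_succ, Nat.succ_eq_add_one, this]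
    push_cast; ring
  rw [e] at h
  rw [div_eq_inv_mul, ← one_div, ← h]
  refine setIntegral_congr_fun measurableSet_Ioi fun r _ ↦ ?_
  simp only [Real.rpow_natCast, Real.rpow_two]
  rw [pow_add, mul_assoc]

/-- The substitution `x = r²` turns the radial integral into a beta integral; the factor `1/2` is
its Jacobian. -/
theorem integral_Ioi_radialWeight {n : ℕ} (hn : 1 ≤ n) {a b : ℝ} (ha : -1 < a)
    (hb : -(n : ℝ) < b) (k : ℕ) :
    ∫ r in Ioi (0 : ℝ), r ^ (2 * n - 1) * (r ^ (2 * k) * radialWeight a b r) =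
      ProbabilityTheory.beta (b + n + k) (a + 1) / 2 := by
  have hk : (0 : ℝ) ≤ k := Nat.cast_nonneg k
  rw [← integral_Ioo_eq_beta (by linarith) (by linarith), ← Ioi_inter_Iio,
    ← setIntegral_indicator measurableSet_Iio, ← integral_comp_rpow_Ioi_of_pos
      (g := indicator (Iio 1) fun x : ℝ ↦ x ^ (b + n + k - 1) * (1 - x) ^ (a + 1 - 1)) two_pos,
    ← integral_div]
  refine setIntegral_congr_fun measurableSet_Ioi fun r (hr : 0 < r) ↦ ?_
  have hiff : r < 1 ↔ r ^ 2 < 1 := by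
    constructor <;> intro h <;> nlinarith
  simp only [Real.rpow_two, indicator, mem_Iio, radialWeight, hiff]
  split_ifs with h
  · have e1 : (r ^ 2) ^ (b + n + k - 1) = r ^ (2 * b) * r ^ (2 * n - 1) * r ^ (2 * k) * r⁻¹ := by
      rw [← Real.rpow_two, ← Real.rpow_mul hr.le, ← Real.rpow_natCast, ← Real.rpow_natCast,
        ← Real.rpow_neg_one r, ← Real.rpow_add hr, ← Real.rpow_add hr, ← Real.rpow_add hr]
      congr 1
      have : 1 ≤ 2 * n := by omega
      push_cast [Nat.cast_sub this]
      ring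
    rw [e1, smul_eq_mul, add_sub_cancel_right, show (2 : ℝ) - 1 = 1 by norm_num, Real.rpow_one]
    field_simp
  · simp

/-- The moments of a linear functional with respect to a radial weight. -/
theorem integral_herm_radialWeight {n : ℕ} (hn : 1 ≤ n) {a b : ℝ} (ha : -1 < a)
    (hb : -(n : ℝ) < b) (z : Cn n) (k : ℕ) :
    ∫ w : Cn n, ‖herm w z‖ ^ (2 * k) * radialWeight a b ‖w‖ =
      Real.pi ^ n * k.factorial / Real.Gamma (n + k) *
        ProbabilityTheory.beta (b + n + k) (a + 1) * ‖z‖ ^ (2 * k) := by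
  have : Nonempty (Fin n) := ⟨⟨0, hn⟩⟩
  have : Nontrivial (Cn n) := by
    refine ⟨⟨0, EuclideanSpace.single ⟨0, hn⟩ 1, fun h ↦ ?_⟩⟩
    have := congrArg (fun v : Cn n ↦ ‖v‖) h
    simp at this
  have hp : ∀ r : ℝ, 0 < r → ∀ x : Cn n,
      ‖herm (r • x) z‖ ^ (2 * k) = r ^ (2 * k) * ‖herm x z‖ ^ (2 * k) := by
    intro r hr x
    rw [herm_eq_inner, herm_eq_inner, inner_smul_right_eq_smul, norm_smul, mul_pow,
      Real.norm_of_nonneg hr.le]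
  -- The Gaussian and the weight share the same integral over the sphere. Its value follows from the
  -- Gaussian moment and is then substituted, so it is never computed directly.
  have h1 := integral_homogeneous_mul_fun_norm (volume : Measure (Cn n))
    (fun x ↦ ‖herm x z‖ ^ (2 * k)) (2 * k) hp (fun r ↦ Real.exp (-r ^ 2))
  have h2 := integral_homogeneous_mul_fun_norm (volume : Measure (Cn n))
    (fun x ↦ ‖herm x z‖ ^ (2 * k)) (2 * k) hp (radialWeight a b)
  rw [finrank_real_Cn] at h1 h2
  rw [integral_gaussian_herm hn, integral_Ioi_gaussian_radial hn] at h1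
  rw [integral_Ioi_radialWeight hn ha hb] at h2
  have hG : 0 < Real.Gamma (n + k) := Real.Gamma_pos_of_pos (by positivity)
  rw [h2]
  field_simp
  rw [mul_comm (_ * _) (‖z‖ ^ (2 * k)), ← mul_assoc] at *
  field_simp at h1
  linear_combination (-ProbabilityTheory.beta (b + n + k) (a + 1)) * h1

/-- The normalising constant of `mu`. -/
noncomputable def muConst (n : ℕ) (a b : ℝ) : ℝ :=
  ((n - 1).factorial : ℝ) / (Real.pi ^ n * ProbabilityTheory.beta (a + 1) (b + n))

theorem muConst_pos {n : ℕ} {a b : ℝ} (ha : -1 < a) (hb : -(n : ℝ) < b) : 0 < muConst n a b := by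
  have := ProbabilityTheory.beta_pos (α := a + 1) (β := b + n) (by linarith) (by linarith)
  unfold muConst
  positivity

theorem mu_eq_withDensity (n : ℕ) (a b : ℝ) :
    mu n a b = (volume : Measure (Cn n)).withDensity
      fun w ↦ ENNReal.ofReal (muConst n a b * radialWeight a b ‖w‖) := by
  rw [mu, ← withDensity_indicator measurableSet_ball]
  congr 1
  funext w
  simp only [indicator, Metric.mem_ball, dist_zero_right, radialWeight, muConst]
  split_ifs with h
  · rw [mul_assoc]
  · simp

theorem integral_mu {n : ℕ} {a b : ℝ} (ha : -1 < a) (hb : -(n : ℝ) < b) (f : Cn n → ℝ) :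
    ∫ w, f w ∂mu n a b = muConst n a b * ∫ w, f w * radialWeight a b ‖w‖ := by
  rw [mu_eq_withDensity, integral_withDensity_eq_integral_toReal_smul, ← integral_const_mul]
  · refine integral_congr_ae (.of_forall fun w ↦ ?_)
    simp only
    rw [ENNReal.toReal_ofReal (mul_nonneg (muConst_pos ha hb).le
      (radialWeight_nonneg a b (norm_nonneg w))), smul_eq_mul]
    ring
  · exact ((measurable_radialWeight a b).comp measurable_norm |>.const_mul _).ennreal_ofReal
  · exact .of_forall fun _ ↦ ENNReal.ofReal_lt_top

/-- The Taylor coefficients of `calK`. -/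
noncomputable def coeffK (n : ℕ) (a b : ℝ) (k : ℕ) : ℝ :=
  ordinaryHypergeometricCoefficient (n : ℝ) (a + b + n + 1) (b + n) k

theorem coeffK_pos {n : ℕ} (hn : 1 ≤ n) {a b : ℝ} (ha : -1 < a) (hb : -(n : ℝ) < b) (k : ℕ) :
    0 < coeffK n a b k := by
  have h1 := ascPochhammer_pos (S := ℝ) k n (by positivity)
  have h2 := ascPochhammer_pos (S := ℝ) k (a + b + n + 1) (by linarith)
  have h3 := ascPochhammer_pos (S := ℝ) k (b + n) (by linarith)
  unfold coeffK ordinaryHypergeometricCoefficient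
  positivity

/-- The moments of a linear functional with respect to `mu`. -/
theorem integral_norm_herm_pow_mu {n : ℕ} (hn : 1 ≤ n) {a b : ℝ} (ha : -1 < a)
    (hb : -(n : ℝ) < b) (z : Cn n) (k : ℕ) :
    ∫ w, ‖herm w z‖ ^ (2 * k) ∂mu n a b = (coeffK n a b k)⁻¹ * ‖z‖ ^ (2 * k) := by
  have hk : (0 : ℝ) ≤ k := Nat.cast_nonneg k
  rw [integral_mu ha hb, integral_herm_radialWeight hn ha hb, ← mul_assoc]
  congr 1
  have hn0 : (0 : ℝ) < n := by positivity
  have e1 := eval_ascPochhammer_mul_Gamma hn0 k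
  have e2 := eval_ascPochhammer_mul_Gamma (x := a + b + n + 1) (by linarith) k
  have e3 := eval_ascPochhammer_mul_Gamma (x := b + n) (by linarith) k
  have p1 := ascPochhammer_pos (S := ℝ) k n (by positivity)
  have p2 := ascPochhammer_pos (S := ℝ) k (a + b + n + 1) (by linarith)
  have p3 := ascPochhammer_pos (S := ℝ) k (b + n) (by linarith)
  have g1 := Real.Gamma_pos_of_pos hn0
  have g2 := Real.Gamma_pos_of_pos (s := a + b + n + 1) (by linarith)
  have g3 := Real.Gamma_pos_of_pos (s := b + n) (by linarith)
  have g4 := Real.Gamma_pos_of_pos (s := a + 1) (by linarith)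
  have hf : ((n - 1).factorial : ℝ) = Real.Gamma n := by
    rw [← Real.Gamma_nat_eq_factorial]
    congr 1
    rw [← Nat.cast_succ]
    congr 1
    omega
  have s1 : a + 1 + (b + n) = a + b + n + 1 := by ring
  have s2 : b + n + k + (a + 1) = a + b + n + 1 + k := by ring
  unfold muConst coeffK ordinaryHypergeometricCoefficient ProbabilityTheory.beta
  rw [hf, s1, s2, ← e1, ← e2, ← e3]
  field_simp

theorem isFiniteMeasure_mu {n : ℕ} (hn : 1 ≤ n) {a b : ℝ} (ha : -1 < a) (hb : -(n : ℝ) < b) :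
    IsFiniteMeasure (mu n a b) := by
  -- A Bochner integral is zero by convention when the integrand is not integrable. The moment of
  -- order zero is nonzero, so constants are integrable and the measure is finite.
  have h : (∫ _ : Cn n, (1 : ℝ) ∂mu n a b) ≠ 0 := by
    have := integral_norm_herm_pow_mu hn ha hb (0 : Cn n) 0
    simp only [mul_zero, pow_zero] at this
    rw [this]
    have := coeffK_pos hn ha hb 0
    positivity
  have hi := Integrable.of_integral_ne_zero h
  rw [integrable_const_iff] at hi
  simpa using hi

/-! ### The Hermitian product and unitary maps -/

section Herm

variable {n : ℕ}

theorem continuous_herm_left (z : Cn n) : Continuous fun w : Cn n ↦ herm w z := by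
  simp only [herm_eq_inner]
  fun_prop

theorem norm_herm_le (w z : Cn n) : ‖herm w z‖ ≤ ‖w‖ * ‖z‖ := by
  rw [herm_eq_inner, mul_comm]
  exact norm_inner_le_norm z w

theorem norm_herm_lt_one {w z : Cn n} (hw : w ∈ unitBall n) (hz : z ∈ unitBall n) :
    ‖herm w z‖ < 1 := by
  rw [mem_ball_zero_iff] at hw hz
  exact (norm_herm_le w z).trans_lt (mul_lt_one_of_nonneg_of_lt_one_left (norm_nonneg _) hw hz.le)

theorem norm_herm_le_of_mem {w : Cn n} (hw : w ∈ unitBall n) (z : Cn n) : ‖herm w z‖ ≤ ‖z‖ := by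
  rw [mem_ball_zero_iff] at hw
  exact (norm_herm_le w z).trans (mul_le_of_le_one_left (norm_nonneg _) hw.le)

theorem conj_herm (w z : Cn n) : conj (herm w z) = herm z w := by
  rw [herm_eq_inner, herm_eq_inner, inner_conj_symm]

theorem herm_self (z : Cn n) : herm z z = ((‖z‖ ^ 2 : ℝ) : ℂ) := by
  rw [herm_eq_inner, inner_self_eq_norm_sq_to_K]
  norm_cast

/-- The unitary map fixing `z` and acting as the scalar `ζ` on its orthogonal complement. -/
theorem exists_isometry_rotation (z : Cn n) {ζ : ℂ} (hζ : ‖ζ‖ = 1) :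
    ∃ U : Cn n ≃ₗᵢ[ℂ] Cn n, (∀ w, herm (U w) z = herm w z) ∧
      ∀ v, herm z v = 0 → ∀ w, herm (U w) v = ζ * herm w v := by
  let P : Cn n →ₗ[ℂ] Cn n := ((ℂ ∙ z).starProjection : Cn n →L[ℂ] Cn n).toLinearMap
  have hPz : ∀ w, inner ℂ z (P w) = inner ℂ z w := fun w ↦ by
    have := Submodule.starProjection_inner_eq_zero (K := ℂ ∙ z) w z
      (Submodule.mem_span_singleton_self z)
    rw [inner_sub_left, sub_eq_zero] at this
    rw [← inner_conj_symm, ← inner_conj_symm z w, this]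
    rfl
  have hP : ∀ w v, inner ℂ z v = 0 → inner ℂ v (P w) = 0 := fun w v hv ↦ by
    obtain ⟨c, hc⟩ := Submodule.mem_span_singleton.1
      ((ℂ ∙ z).starProjection_apply_mem w)
    have : P w = c • z := hc.symm
    rw [this, inner_smul_right, ← inner_conj_symm, hv]
    simp
  -- With `P` the orthogonal projection onto the line of `z`, this is the identity on that line and
  -- `ζ` on its complement; Pythagoras makes it an isometry.
  let L : Cn n →ₗ[ℂ] Cn n := P + ζ • (LinearMap.id - P)
  have hL : ∀ w, L w = P w + ζ • (w - P w) := fun w ↦ rfl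
  have horth : ∀ w, inner ℂ (P w) (w - P w) = 0 := fun w ↦ by
    have h : inner ℂ (w - P w) (P w) = 0 :=
      Submodule.starProjection_inner_eq_zero (K := ℂ ∙ z) w (P w)
        ((ℂ ∙ z).starProjection_apply_mem w)
    rw [← inner_conj_symm, h, map_zero]
  have hnorm : ∀ w, ‖L w‖ = ‖w‖ := fun w ↦ by
    rw [← sq_eq_sq₀ (norm_nonneg _) (norm_nonneg _), hL, sq, sq,
      norm_add_sq_eq_norm_sq_add_norm_sq_of_inner_eq_zero (𝕜 := ℂ) _ _
        (by rw [inner_smul_right, horth, mul_zero]), norm_smul, hζ, one_mul,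
      ← norm_add_sq_eq_norm_sq_add_norm_sq_of_inner_eq_zero (𝕜 := ℂ) _ _ (horth w),
      add_sub_cancel]
  refine ⟨(LinearIsometry.mk L hnorm).toLinearIsometryEquiv rfl, fun w ↦ ?_, fun v hv w ↦ ?_⟩
  · change herm (L w) z = _
    rw [hL, herm_eq_inner, herm_eq_inner, inner_add_right, inner_smul_right, inner_sub_right, hPz]
    ring
  · change herm (L w) v = _
    have hv' : inner ℂ z v = 0 := by
      rw [herm_eq_inner] at hv
      rw [← inner_conj_symm, hv]
      simp
    rw [hL, herm_eq_inner, herm_eq_inner, inner_add_right, inner_smul_right, inner_sub_right,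
      hP w v hv']
    ring

end Herm

/-! ### Mixed moments by unitary invariance -/

section Moments

variable {n : ℕ} {a b : ℝ}

theorem ae_mem_unitBall (n : ℕ) (a b : ℝ) : ∀ᵐ w ∂mu n a b, w ∈ unitBall n :=
  (withDensity_absolutelyContinuous _ _).ae_le (ae_restrict_mem measurableSet_ball)

theorem aestronglyMeasurable_of_continuousOn {F : Type*} [NormedAddCommGroup F] {f : Cn n → F}
    (hf : ContinuousOn f (unitBall n)) : AEStronglyMeasurable f (mu n a b) :=
  (hf.aestronglyMeasurable measurableSet_ball).mono_ac (withDensity_absolutelyContinuous _ _)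

theorem integrable_of_continuousOn_of_bound [IsFiniteMeasure (mu n a b)]
    {F : Type*} [NormedAddCommGroup F] {f : Cn n → F}
    (hf : ContinuousOn f (unitBall n)) {C : ℝ} (hC : ∀ w ∈ unitBall n, ‖f w‖ ≤ C) :
    Integrable f (mu n a b) :=
  .of_bound (aestronglyMeasurable_of_continuousOn hf) C
    ((ae_mem_unitBall n a b).mono hC)

theorem measurePreserving_mu (U : Cn n ≃ₗᵢ[ℂ] Cn n) :
    MeasurePreserving U (mu n a b) (mu n a b) := by
  let U' : Cn n ≃ₗᵢ[ℝ] Cn n :=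
    { toLinearEquiv := U.toLinearEquiv.restrictScalars ℝ, norm_map' := U.norm_map }
  have hmp : MeasurePreserving U' := U'.measurePreserving
  refine ⟨U.continuous.measurable, ?_⟩
  ext s hs
  have hm : MeasurableSet (U' ⁻¹' s) := U'.continuous.measurable hs
  rw [Measure.map_apply U.continuous.measurable hs, mu_eq_withDensity, withDensity_apply _ hs]
  change (volume.withDensity _) (U' ⁻¹' s) = _
  rw [withDensity_apply _ hm, ← hmp.setLIntegral_comp_preimage hs]
  · refine lintegral_congr fun w ↦ ?_
    rw [U'.norm_map]
  · exact ((measurable_radialWeight a b).comp measurable_norm |>.const_mul _).ennreal_ofReal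

/-- A function transforming under a unitary map by a scalar other than `1` has zero integral. -/
theorem integral_eq_zero_of_isometry (U : Cn n ≃ₗᵢ[ℂ] Cn n) {ζ : ℂ} (hζ : ζ ≠ 1) {f : Cn n → ℂ}
    (hf : ∀ w, f (U w) = ζ * f w) : ∫ w, f w ∂mu n a b = 0 := by
  have h := (measurePreserving_mu (a := a) (b := b) U).integral_comp
    U.toHomeomorph.measurableEmbedding f
  simp only [hf, integral_const_mul] at h
  have : (ζ - 1) * ∫ w, f w ∂mu n a b = 0 := by rw [sub_mul, h]; ring
  exact (mul_eq_zero.1 this).resolve_left (sub_ne_zero.2 hζ)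

theorem exists_norm_one_pow_eq_neg_one {l : ℕ} (hl : l ≠ 0) : ∃ ζ : ℂ, ‖ζ‖ = 1 ∧ ζ ^ l = -1 := by
  refine ⟨Complex.exp ((Real.pi / l : ℝ) * Complex.I), Complex.norm_exp_ofReal_mul_I _, ?_⟩
  rw [← Complex.exp_nat_mul, ← Complex.exp_pi_mul_I]
  congr 1
  have : (l : ℂ) ≠ 0 := Nat.cast_ne_zero.2 hl
  push_cast
  field_simp

theorem integral_herm_pow_mul_conj_of_lt (z z' : Cn n) {j k : ℕ} (hjk : j < k) :
    ∫ w, herm w z ^ j * conj (herm w z') ^ k ∂mu n a b = 0 := by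
  obtain ⟨ζ, hζ, hζl⟩ := exists_norm_one_pow_eq_neg_one (Nat.sub_ne_zero_of_lt hjk)
  -- Every vector is orthogonal to `0`, so here `U` is multiplication by `ζ`. The integrand is
  -- multiplied by `ζ^j conj(ζ)^k = conj(ζ)^(k-j) = -1`.
  obtain ⟨U, -, hU⟩ := exists_isometry_rotation (0 : Cn n) hζ
  have h0 : ∀ v : Cn n, herm 0 v = 0 := fun v ↦ by simp [herm]
  have hζc : ζ * conj ζ = 1 := by rw [Complex.mul_conj']; simp [hζ]
  refine integral_eq_zero_of_isometry U (ζ := -1) (by norm_num) fun w ↦ ?_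
  rw [hU z (h0 z), hU z' (h0 z'), map_mul, mul_pow, mul_pow]
  have : ζ ^ j * conj ζ ^ k = -1 := by
    obtain ⟨l, rfl⟩ := Nat.exists_eq_add_of_lt hjk
    have hl : j + l + 1 - j = l + 1 := by omega
    rw [hl] at hζl
    have h2 : conj ζ ^ (l + 1) = -1 := by rw [← map_pow, hζl]; simp
    rw [add_assoc, pow_add, ← mul_assoc, ← mul_pow, hζc, h2]
    simp
  linear_combination (herm w z ^ j * conj (herm w z') ^ k) * this

theorem integral_herm_pow_mul_conj_of_ne (z z' : Cn n) {j k : ℕ} (hjk : j ≠ k) :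
    ∫ w, herm w z ^ j * conj (herm w z') ^ k ∂mu n a b = 0 := by
  rcases hjk.lt_or_gt with h | h
  · exact integral_herm_pow_mul_conj_of_lt z z' h
  · have := integral_herm_pow_mul_conj_of_lt (a := a) (b := b) z' z h
    rw [← map_eq_zero conj, ← integral_conj] at this
    rw [← this]
    refine integral_congr_ae (.of_forall fun w ↦ ?_)
    simp [mul_comm]

/-- Split `z' = α z + v` with `v` orthogonal to `z` and expand binomially. A unitary map fixing `z`
and rotating `v` kills every term containing `v`; what remains is a moment of `⟨w,z⟩` alone. -/
theorem integral_herm_pow_mul_conj_self (hn : 1 ≤ n) (ha : -1 < a) (hb : -(n : ℝ) < b)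
    (z z' : Cn n) (k : ℕ) :
    ∫ w, herm w z ^ k * conj (herm w z') ^ k ∂mu n a b =
      ((coeffK n a b k)⁻¹ : ℝ) * herm z' z ^ k := by
  have := isFiniteMeasure_mu hn ha hb
  set α : ℂ := herm z' z / herm z z with hα
  set v : Cn n := z' - α • z with hv
  have hzz : herm z z = 0 → z = 0 := fun h ↦ by
    rw [herm_self] at h
    simpa using h
  -- For `z = 0` the quotient `α` is `0` by convention and the identity still holds, so no separate
  -- case is needed later.
  have hαz : α * herm z z = herm z' z := by
    rcases eq_or_ne (herm z z) 0 with h | h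
    · have : z = 0 := hzz h
      subst this
      simp [herm]
    · rw [hα, div_mul_cancel₀ _ h]
  have hzv : herm z v = 0 := by
    rw [← conj_herm, map_eq_zero, herm_eq_inner, hv, inner_sub_right, inner_smul_right,
      ← herm_eq_inner, ← herm_eq_inner, hαz, sub_self]
  have hexp : ∀ w, conj (herm w z') = conj (herm w v) + α * conj (herm w z) := fun w ↦ by
    rw [conj_herm, conj_herm, conj_herm, herm_eq_inner, herm_eq_inner, herm_eq_inner, hv,
      inner_sub_right, inner_smul_right]
    ring
  have hterm : ∀ l, l ≠ 0 → ∫ w, herm w z ^ k * (conj (herm w v) ^ l *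
      (α * conj (herm w z)) ^ (k - l) * (k.choose l : ℂ)) ∂mu n a b = 0 := by
    intro l hl
    obtain ⟨ζ, hζ, hζl⟩ := exists_norm_one_pow_eq_neg_one hl
    obtain ⟨U, hU1, hU2⟩ := exists_isometry_rotation z hζ
    refine integral_eq_zero_of_isometry U (ζ := -1) (by norm_num) fun w ↦ ?_
    have h2 : conj ζ ^ l = -1 := by rw [← map_pow, hζl]; simp
    rw [hU1, hU2 v hzv, map_mul, mul_pow, h2]
    ring
  simp only [hexp, add_pow, Finset.mul_sum]
  rw [integral_finsetSum]
  · rw [Finset.sum_eq_single 0 (fun l _ hl ↦ hterm l hl) (by simp)]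
    simp only [pow_zero, Nat.sub_zero, Nat.choose_zero_right, Nat.cast_one, mul_one, one_mul,
      mul_pow]
    have e : ∀ w : Cn n, herm w z ^ k * (α ^ k * conj (herm w z) ^ k) =
        α ^ k * ((‖herm w z‖ ^ (2 * k) : ℝ) : ℂ) := fun w ↦ by
      push_cast
      rw [pow_mul, ← Complex.mul_conj', mul_pow]
      ring
    simp only [e]
    rw [integral_const_mul, integral_complex_ofReal, integral_norm_herm_pow_mu hn ha hb, ← hαz,
      mul_pow, herm_self]
    push_cast
    ring
  · intro l _
    refine integrable_of_continuousOn_of_bound (Continuous.continuousOn ?_)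
      (C := ‖z‖ ^ k * (‖v‖ ^ l * (‖α‖ * ‖z‖) ^ (k - l) * k.choose l)) fun w hw ↦ ?_
    · have h1 := continuous_herm_left z
      have h2 := continuous_herm_left v
      have h3 := Complex.continuous_conj.comp h1
      have h4 := Complex.continuous_conj.comp h2
      simp only [Function.comp_def] at h3 h4
      fun_prop
    · have h1 := norm_herm_le_of_mem hw z
      have h2 := norm_herm_le_of_mem hw v
      simp only [norm_mul, norm_pow, RCLike.norm_conj, RCLike.norm_natCast]
      gcongr

end Moments

variable {n : ℕ} {a b : ℝ}

/-! ### Analyticity of the hypergeometric kernel -/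

theorem summable_coeffK (ha : -1 < a) (hb : -(n : ℝ) < b) (hn : 1 ≤ n) {r : ℝ} (hr0 : 0 ≤ r)
    (hr : r < 1) : Summable fun k ↦ coeffK n a b k * r ^ k := by
  have hrad : (ordinaryHypergeometricSeries ℝ (n : ℝ) (a + b + n + 1) (b + n)).radius = 1 := by
    -- All three parameters are positive, so none is a nonpositive integer: the series neither
    -- terminates nor has a vanishing denominator.
    refine ordinaryHypergeometricSeries_radius_eq_one ℝ _ _ _ fun k ↦ ?_
    have hk : (0 : ℝ) ≤ k := Nat.cast_nonneg k
    have hn' : (1 : ℝ) ≤ n := Nat.one_le_cast.2 hn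
    refine ⟨?_, ?_, ?_⟩ <;> intro h <;> linarith
  have h := FormalMultilinearSeries.summable_norm_apply
    (ordinaryHypergeometricSeries ℝ (n : ℝ) (a + b + n + 1) (b + n)) (x := r) (by
      rw [hrad, mem_eball_zero_iff, ← ofReal_norm, Real.norm_of_nonneg hr0]
      simpa using hr)
  refine h.of_norm_bounded fun k ↦ le_of_eq ?_
  rw [ordinaryHypergeometricSeries_apply_eq]
  rfl

theorem calK_complex_eq_tsum (n : ℕ) (a b : ℝ) (ξ : ℂ) :
    calK n a b ξ = ∑' k, (coeffK n a b k : ℂ) * ξ ^ k := by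
  rw [calK, ordinaryHypergeometric_eq_tsum]
  exact tsum_congr fun k ↦ Complex.real_smul

theorem calK_real_eq_tsum (n : ℕ) (a b : ℝ) (x : ℝ) :
    calK n a b x = ∑' k, coeffK n a b k * x ^ k := by
  rw [calK, ordinaryHypergeometric_eq_tsum]
  rfl

theorem ofReal_calK (n : ℕ) (a b : ℝ) (x : ℝ) :
    ((calK n a b x : ℝ) : ℂ) = calK n a b (x : ℂ) := by
  rw [calK_complex_eq_tsum, calK_real_eq_tsum, Complex.ofReal_tsum]
  push_cast
  rfl

theorem calK_zero (n : ℕ) (a b : ℝ) : calK n a b (0 : ℂ) = 1 :=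
  ordinaryHypergeometric_zero _ _ _

theorem norm_coeffK_mul_pow_le (hn : 1 ≤ n) (ha : -1 < a) (hb : -(n : ℝ) < b) {r : ℝ} {ξ : ℂ}
    (hξ : ‖ξ‖ ≤ r) (k : ℕ) : ‖(coeffK n a b k : ℂ) * ξ ^ k‖ ≤ coeffK n a b k * r ^ k := by
  have := coeffK_pos hn ha hb k
  rw [norm_mul, norm_pow, Complex.norm_real, Real.norm_of_nonneg this.le]
  gcongr

theorem differentiableOn_calK (hn : 1 ≤ n) (ha : -1 < a) (hb : -(n : ℝ) < b) :
    DifferentiableOn ℂ (calK n a b : ℂ → ℂ) (Metric.ball 0 1) := by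
  intro ξ hξ
  rw [mem_ball_zero_iff] at hξ
  obtain ⟨r, hr1, hr2⟩ := exists_between hξ
  have h : DifferentiableOn ℂ (fun ξ : ℂ ↦ ∑' k, (coeffK n a b k : ℂ) * ξ ^ k)
      (Metric.ball 0 r) :=
    Complex.differentiableOn_tsum_of_summable_norm
      (summable_coeffK ha hb hn ((norm_nonneg _).trans hr1.le) hr2) (fun k ↦ by fun_prop)
      Metric.isOpen_ball
      fun k w hw ↦ norm_coeffK_mul_pow_le hn ha hb (mem_ball_zero_iff.1 hw).le k
  simp only [← calK_complex_eq_tsum] at h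
  exact (h.differentiableAt (Metric.isOpen_ball.mem_nhds
    (mem_ball_zero_iff.2 hr1))).differentiableWithinAt

theorem hasDerivAt_calK (hn : 1 ≤ n) (ha : -1 < a) (hb : -(n : ℝ) < b) {ξ : ℂ} (hξ : ‖ξ‖ < 1) :
    HasDerivAt (calK n a b : ℂ → ℂ) (deriv (calK n a b) ξ) ξ :=
  ((differentiableOn_calK hn ha hb).differentiableAt (Metric.isOpen_ball.mem_nhds
    (mem_ball_zero_iff.2 hξ))).hasDerivAt

theorem differentiableOn_deriv_calK (hn : 1 ≤ n) (ha : -1 < a) (hb : -(n : ℝ) < b) :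
    DifferentiableOn ℂ (deriv (calK n a b : ℂ → ℂ)) (Metric.ball 0 1) :=
  (differentiableOn_calK hn ha hb).deriv Metric.isOpen_ball

theorem hasDerivAt_deriv_calK (hn : 1 ≤ n) (ha : -1 < a) (hb : -(n : ℝ) < b) {ξ : ℂ}
    (hξ : ‖ξ‖ < 1) :
    HasDerivAt (deriv (calK n a b : ℂ → ℂ)) (deriv (deriv (calK n a b)) ξ) ξ :=
  ((differentiableOn_deriv_calK hn ha hb).differentiableAt (Metric.isOpen_ball.mem_nhds
    (mem_ball_zero_iff.2 hξ))).hasDerivAt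

theorem continuousOn_deriv_deriv_calK (hn : 1 ≤ n) (ha : -1 < a) (hb : -(n : ℝ) < b) :
    ContinuousOn (deriv (deriv (calK n a b : ℂ → ℂ))) (Metric.ball 0 1) :=
  ((differentiableOn_deriv_calK hn ha hb).deriv Metric.isOpen_ball).continuousOn

theorem calK_real_pos (hn : 1 ≤ n) (ha : -1 < a) (hb : -(n : ℝ) < b) {x : ℝ} (h0 : 0 ≤ x)
    (h1 : x < 1) : 0 < calK n a b x := by
  rw [calK_real_eq_tsum]
  refine (summable_coeffK ha hb hn h0 h1).tsum_pos (fun k ↦ ?_) 0 ?_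
  · have := coeffK_pos hn ha hb k
    positivity
  · simpa using coeffK_pos hn ha hb 0

/-- The derivative of `calK` on `(-1, 1)`. -/
noncomputable def calKDeriv (n : ℕ) (a b : ℝ) (x : ℝ) : ℝ := (deriv (calK n a b : ℂ → ℂ) x).re

/-- The second derivative of `calK` on `(-1, 1)`. -/
noncomputable def calKDeriv₂ (n : ℕ) (a b : ℝ) (x : ℝ) : ℝ :=
  (deriv (deriv (calK n a b : ℂ → ℂ)) x).re

theorem hasDerivAt_calK_real (hn : 1 ≤ n) (ha : -1 < a) (hb : -(n : ℝ) < b) {x : ℝ}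
    (hx : |x| < 1) : HasDerivAt (calK n a b : ℝ → ℝ) (calKDeriv n a b x) x := by
  have h := (hasDerivAt_calK hn ha hb (ξ := x) (by simpa using hx)).real_of_complex
  simpa only [← ofReal_calK, Complex.ofReal_re] using! h

theorem ofReal_calKDeriv (hn : 1 ≤ n) (ha : -1 < a) (hb : -(n : ℝ) < b) {x : ℝ}
    (hx : |x| < 1) : ((calKDeriv n a b x : ℝ) : ℂ) = deriv (calK n a b : ℂ → ℂ) x := by
  have h1 := (hasDerivAt_calK hn ha hb (ξ := x) (by simpa using hx)).comp_ofReal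
  have h2 := (hasDerivAt_calK_real hn ha hb hx).ofReal_comp
  simp only [ofReal_calK] at h2
  exact h2.unique h1

theorem hasDerivAt_calKDeriv (hn : 1 ≤ n) (ha : -1 < a) (hb : -(n : ℝ) < b) {x : ℝ}
    (hx : |x| < 1) : HasDerivAt (calKDeriv n a b) (calKDeriv₂ n a b x) x :=
  (hasDerivAt_deriv_calK hn ha hb (ξ := x) (by simpa using hx)).real_of_complex

theorem ofReal_calKDeriv₂ (hn : 1 ≤ n) (ha : -1 < a) (hb : -(n : ℝ) < b) {x : ℝ}
    (hx : |x| < 1) : ((calKDeriv₂ n a b x : ℝ) : ℂ) = deriv (deriv (calK n a b : ℂ → ℂ)) x := by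
  have h1 := (hasDerivAt_deriv_calK hn ha hb (ξ := x) (by simpa using hx)).comp_ofReal
  have h2 := (hasDerivAt_calKDeriv hn ha hb hx).ofReal_comp
  refine (h2.congr_of_eventuallyEq ?_).unique h1 |>.symm ▸ rfl
  filter_upwards [(isOpen_Iio.preimage continuous_abs).mem_nhds hx] with y hy
  exact (ofReal_calKDeriv hn ha hb hy).symm

theorem continuousOn_calKDeriv₂ (hn : 1 ≤ n) (ha : -1 < a) (hb : -(n : ℝ) < b) :
    ContinuousOn (calKDeriv₂ n a b) {x | |x| < 1} := by
  refine Complex.continuous_re.comp_continuousOn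
    ((continuousOn_deriv_deriv_calK hn ha hb).comp Complex.continuous_ofReal.continuousOn ?_)
  intro x hx
  simpa using hx

/-! ### The reproducing property -/

/-- Integration of the kernel against an integrable function, term by term. -/
theorem hasSum_integral_calK_herm (hn : 1 ≤ n) (ha : -1 < a) (hb : -(n : ℝ) < b) {z : Cn n}
    (hz : z ∈ unitBall n) {g : Cn n → ℂ} (hg : Integrable g (mu n a b)) :
    HasSum (fun k ↦ (coeffK n a b k : ℂ) * ∫ w, herm w z ^ k * g w ∂mu n a b)
      (∫ w, calK n a b (herm w z) * g w ∂mu n a b) := by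
  have hbound : ∀ k, ∀ᵐ w ∂mu n a b,
      ‖(coeffK n a b k : ℂ) * herm w z ^ k‖ ≤ coeffK n a b k * ‖z‖ ^ k := fun k ↦ by
    filter_upwards [ae_mem_unitBall n a b] with w hw
    exact norm_coeffK_mul_pow_le hn ha hb (norm_herm_le_of_mem hw z) k
  have hint : ∀ k, Integrable (fun w ↦ (coeffK n a b k : ℂ) * herm w z ^ k * g w) (mu n a b) :=
    fun k ↦ hg.bdd_mul (((continuous_herm_left z).pow k).const_mul _).aestronglyMeasurable
      (hbound k)
  have h := hasSum_integral_of_summable_integral_norm hint (by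
    rw [mem_ball_zero_iff] at hz
    refine ((summable_coeffK ha hb hn (norm_nonneg z) hz).mul_right
      (∫ w, ‖g w‖ ∂mu n a b)).of_nonneg_of_le (fun k ↦ by positivity) fun k ↦ ?_
    rw [← integral_const_mul]
    refine integral_mono_ae (hint k).norm (hg.norm.const_mul _) ?_
    filter_upwards [hbound k] with w hw
    rw [norm_mul]
    gcongr)
  simp only [tsum_mul_right, ← calK_complex_eq_tsum] at h
  simpa only [mul_assoc, integral_const_mul] using h

theorem continuousOn_calK_herm (hn : 1 ≤ n) (ha : -1 < a) (hb : -(n : ℝ) < b) {z : Cn n}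
    (hz : z ∈ unitBall n) : ContinuousOn (fun w ↦ calK n a b (herm w z)) (unitBall n) :=
  (differentiableOn_calK hn ha hb).continuousOn.comp (continuous_herm_left z).continuousOn
    fun _ hw ↦ mem_ball_zero_iff.2 (norm_herm_lt_one hw hz)

theorem continuousOn_deriv_calK_herm (hn : 1 ≤ n) (ha : -1 < a) (hb : -(n : ℝ) < b) {z : Cn n}
    (hz : z ∈ unitBall n) :
    ContinuousOn (fun w ↦ deriv (calK n a b : ℂ → ℂ) (herm w z)) (unitBall n) :=
  (differentiableOn_deriv_calK hn ha hb).continuousOn.comp (continuous_herm_left z).continuousOn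
    fun _ hw ↦ mem_ball_zero_iff.2 (norm_herm_lt_one hw hz)

/-- A function holomorphic on the unit disc is bounded on smaller discs. -/
theorem exists_norm_le_of_continuousOn_disc {g : ℂ → ℂ} (hg : ContinuousOn g (Metric.ball 0 1))
    {r : ℝ} (hr : r < 1) : ∃ C, 0 ≤ C ∧ ∀ ξ : ℂ, ‖ξ‖ ≤ r → ‖g ξ‖ ≤ C := by
  obtain ⟨C, hC⟩ := (isCompact_closedBall (0 : ℂ) r).exists_bound_of_continuousOn
    (hg.mono (Metric.closedBall_subset_ball hr))
  exact ⟨max C 0, le_max_right _ _, fun ξ hξ ↦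
    (hC ξ (mem_closedBall_zero_iff.2 hξ)).trans (le_max_left _ _)⟩

/-- The reproducing property of the kernel `calK (herm w z)`. -/
theorem integral_calK_mul_conj_calK (hn : 1 ≤ n) (ha : -1 < a) (hb : -(n : ℝ) < b) {z z' : Cn n}
    (hz : z ∈ unitBall n) (hz' : z' ∈ unitBall n) :
    ∫ w, calK n a b (herm w z) * conj (calK n a b (herm w z')) ∂mu n a b =
      calK n a b (herm z' z) := by
  have := isFiniteMeasure_mu hn ha hb
  -- Monomials are reproduced first: in the expansion of the conjugated kernel only degree `j`
  -- survives, and its coefficient cancels the moment. Expanding the other kernel in monomials then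
  -- finishes.
  have hmono : ∀ j : ℕ, ∫ w, herm w z ^ j * conj (calK n a b (herm w z')) ∂mu n a b =
      herm z' z ^ j := by
    intro j
    have hi : Integrable (fun w ↦ conj (herm w z) ^ j) (mu n a b) := by
      refine integrable_of_continuousOn_of_bound
        ((Complex.continuous_conj.comp (continuous_herm_left z)).pow j).continuousOn
        (C := ‖z‖ ^ j) fun w hw ↦ ?_
      rw [norm_pow, RCLike.norm_conj]
      gcongr
      exact norm_herm_le_of_mem hw z
    have h := hasSum_integral_calK_herm hn ha hb hz' hi
    have h2 := h.unique (hasSum_single j fun k hk ↦ by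
      rw [integral_herm_pow_mul_conj_of_ne z' z hk, mul_zero])
    rw [integral_herm_pow_mul_conj_self hn ha hb] at h2
    have h3 := congrArg conj h2
    rw [← integral_conj] at h3
    have hc : (coeffK n a b j : ℂ) ≠ 0 := by exact_mod_cast (coeffK_pos hn ha hb j).ne'
    rw [Complex.ofReal_inv, mul_inv_cancel_left₀ hc, map_pow, conj_herm] at h3
    rw [← h3]
    refine integral_congr_ae (.of_forall fun w ↦ ?_)
    simp [mul_comm]
  have hi : Integrable (fun w ↦ conj (calK n a b (herm w z'))) (mu n a b) := by
    obtain ⟨C, -, hC⟩ := exists_norm_le_of_continuousOn_disc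
      (differentiableOn_calK hn ha hb).continuousOn (mem_ball_zero_iff.1 hz')
    refine integrable_of_continuousOn_of_bound
      (Complex.continuous_conj.comp_continuousOn (continuousOn_calK_herm hn ha hb hz'))
      (C := C) fun w hw ↦ ?_
    rw [RCLike.norm_conj]
    exact hC _ (norm_herm_le_of_mem hw z')
  have h := hasSum_integral_calK_herm hn ha hb hz hi
  simp only [hmono] at h
  rw [← h.tsum_eq, calK_complex_eq_tsum]

/-! ### Derivatives of the kernel and their inner products -/

theorem hasDerivAt_herm_right {γ : ℝ → Cn n} {v : Cn n} {t : ℝ} (h : HasDerivAt γ v t)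
    (w : Cn n) : HasDerivAt (fun s ↦ herm w (γ s)) (herm w v) t := by
  simp only [herm_eq_inner]
  simpa using h.inner ℂ (hasDerivAt_const t w)

theorem hasDerivAt_herm_left {γ : ℝ → Cn n} {v : Cn n} {t : ℝ} (h : HasDerivAt γ v t)
    (w : Cn n) : HasDerivAt (fun s ↦ herm (γ s) w) (herm v w) t := by
  simp only [herm_eq_inner]
  simpa using (hasDerivAt_const t w).inner ℂ h

theorem HasDerivAt.conj_comp {g : ℝ → ℂ} {g' : ℂ} {t : ℝ} (h : HasDerivAt g g' t) :
    HasDerivAt (fun s ↦ conj (g s)) (conj g') t :=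
  (Complex.conjCLE : ℂ →L[ℝ] ℂ).hasFDerivAt.comp_hasDerivAt t h

theorem hasDerivAt_calK_herm (hn : 1 ≤ n) (ha : -1 < a) (hb : -(n : ℝ) < b)
    {γ : ℝ → Cn n} {v : Cn n} {t : ℝ} (h : HasDerivAt γ v t) {w : Cn n} (hw : w ∈ unitBall n)
    (hγ : γ t ∈ unitBall n) :
    HasDerivAt (fun s ↦ calK n a b (herm w (γ s)))
      (deriv (calK n a b : ℂ → ℂ) (herm w (γ t)) * herm w v) t :=
  (hasDerivAt_calK hn ha hb (norm_herm_lt_one hw hγ)).comp t (hasDerivAt_herm_right h w)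

/-- Differentiation of integrals against products of kernels along curves in the ball. -/
theorem hasDerivAt_integral_calK_mul_conj_calK (hn : 1 ≤ n) (ha : -1 < a) (hb : -(n : ℝ) < b)
    {γ γ' η η' : ℝ → Cn n} {s : Set ℝ} {t₀ r C : ℝ} (hs : s ∈ nhds t₀) (hr : r < 1)
    (hγ : ∀ t ∈ s, HasDerivAt γ (γ' t) t) (hγ' : ∀ t ∈ s, ‖γ' t‖ ≤ C) (hγr : ∀ t ∈ s, ‖γ t‖ ≤ r)
    (hη : ∀ t ∈ s, HasDerivAt η (η' t) t) (hη' : ∀ t ∈ s, ‖η' t‖ ≤ C) (hηr : ∀ t ∈ s, ‖η t‖ ≤ r)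
    {f : Cn n → ℂ} (hf : Integrable f (mu n a b)) :
    Integrable (fun w ↦ (deriv (calK n a b : ℂ → ℂ) (herm w (γ t₀)) * herm w (γ' t₀) *
        conj (calK n a b (herm w (η t₀))) + calK n a b (herm w (γ t₀)) *
        conj (deriv (calK n a b : ℂ → ℂ) (herm w (η t₀)) * herm w (η' t₀))) * f w) (mu n a b) ∧
    HasDerivAt (fun t ↦ ∫ w, calK n a b (herm w (γ t)) * conj (calK n a b (herm w (η t))) * f w
        ∂mu n a b)
      (∫ w, (deriv (calK n a b : ℂ → ℂ) (herm w (γ t₀)) * herm w (γ' t₀) *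
        conj (calK n a b (herm w (η t₀))) + calK n a b (herm w (γ t₀)) *
        conj (deriv (calK n a b : ℂ → ℂ) (herm w (η t₀)) * herm w (η' t₀))) * f w ∂mu n a b) t₀ := by
  -- Since `|⟨w,x⟩| ≤ ‖x‖ ≤ r < 1` for all `w` in the ball, `𝒦` and its derivative are bounded
  -- uniformly in `w` and `t`. This gives the dominating function.
  obtain ⟨A, hA0, hA⟩ := exists_norm_le_of_continuousOn_disc
    (differentiableOn_calK hn ha hb).continuousOn hr
  obtain ⟨B, hB0, hB⟩ := exists_norm_le_of_continuousOn_disc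
    (differentiableOn_deriv_calK hn ha hb).continuousOn hr
  have ht₀ : t₀ ∈ s := mem_of_mem_nhds hs
  have hC0 : 0 ≤ C := (norm_nonneg _).trans (hγ' t₀ ht₀)
  have hball : ∀ {x : Cn n}, ‖x‖ ≤ r → x ∈ unitBall n := fun h ↦
    mem_ball_zero_iff.2 (h.trans_lt hr)
  have hKc : ∀ {x : Cn n}, ‖x‖ ≤ r → ContinuousOn (fun w ↦ calK n a b (herm w x)) (unitBall n) :=
    fun h ↦ continuousOn_calK_herm hn ha hb (hball h)
  have hDc : ∀ {x : Cn n}, ‖x‖ ≤ r →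
      ContinuousOn (fun w ↦ deriv (calK n a b : ℂ → ℂ) (herm w x)) (unitBall n) :=
    fun h ↦ continuousOn_deriv_calK_herm hn ha hb (hball h)
  have hHc : ∀ x : Cn n, ContinuousOn (fun w ↦ herm w x) (unitBall n) :=
    fun x ↦ (continuous_herm_left x).continuousOn
  have hKb : ∀ {x w : Cn n}, ‖x‖ ≤ r → w ∈ unitBall n → ‖calK n a b (herm w x)‖ ≤ A :=
    fun h hw ↦ hA _ ((norm_herm_le_of_mem hw _).trans h)
  have hDb : ∀ {x v w : Cn n}, ‖x‖ ≤ r → ‖v‖ ≤ C → w ∈ unitBall n →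
      ‖deriv (calK n a b : ℂ → ℂ) (herm w x) * herm w v‖ ≤ B * C := fun h hv hw ↦ by
    rw [norm_mul]
    exact mul_le_mul (hB _ ((norm_herm_le_of_mem hw _).trans h))
      ((norm_herm_le_of_mem hw _).trans hv) (norm_nonneg _) hB0
  have hcF : ∀ t ∈ s, ContinuousOn (fun w ↦ calK n a b (herm w (γ t)) *
      conj (calK n a b (herm w (η t)))) (unitBall n) := fun t ht ↦
    (hKc (hγr t ht)).mul (Complex.continuous_conj.comp_continuousOn (hKc (hηr t ht)))
  refine hasDerivAt_integral_of_dominated_loc_of_deriv_le (𝕜 := ℝ)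
    (F := fun t w ↦ calK n a b (herm w (γ t)) * conj (calK n a b (herm w (η t))) * f w)
    (F' := fun t w ↦ (deriv (calK n a b : ℂ → ℂ) (herm w (γ t)) * herm w (γ' t) *
      conj (calK n a b (herm w (η t))) + calK n a b (herm w (γ t)) *
      conj (deriv (calK n a b : ℂ → ℂ) (herm w (η t)) * herm w (η' t))) * f w)
    (bound := fun w ↦ (B * C * A + A * (B * C)) * ‖f w‖) hs ?_ ?_ ?_ ?_ (hf.norm.const_mul _) ?_
  · filter_upwards [hs] with t ht
    exact (aestronglyMeasurable_of_continuousOn (hcF t ht)).mul hf.aestronglyMeasurable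
  · refine hf.bdd_mul (c := A * A) (aestronglyMeasurable_of_continuousOn (hcF t₀ ht₀)) ?_
    filter_upwards [ae_mem_unitBall n a b] with w hw
    rw [norm_mul, RCLike.norm_conj]
    exact mul_le_mul (hKb (hγr t₀ ht₀) hw) (hKb (hηr t₀ ht₀) hw) (norm_nonneg _) hA0
  · refine (aestronglyMeasurable_of_continuousOn ?_).mul hf.aestronglyMeasurable
    exact (((hDc (hγr t₀ ht₀)).mul (hHc _)).mul
      (Complex.continuous_conj.comp_continuousOn (hKc (hηr t₀ ht₀)))).add
      ((hKc (hγr t₀ ht₀)).mul (Complex.continuous_conj.comp_continuousOn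
        ((hDc (hηr t₀ ht₀)).mul (hHc _))))
  · filter_upwards [ae_mem_unitBall n a b] with w hw t ht
    rw [norm_mul]
    refine mul_le_mul_of_nonneg_right ((norm_add_le _ _).trans (add_le_add ?_ ?_)) (norm_nonneg _)
    · rw [norm_mul, RCLike.norm_conj]
      exact mul_le_mul (hDb (hγr t ht) (hγ' t ht) hw) (hKb (hηr t ht) hw) (norm_nonneg _)
        (by positivity)
    · rw [norm_mul, RCLike.norm_conj]
      exact mul_le_mul (hKb (hγr t ht) hw) (hDb (hηr t ht) (hη' t ht) hw) (norm_nonneg _) hA0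
  · filter_upwards [ae_mem_unitBall n a b] with w hw t ht
    exact ((hasDerivAt_calK_herm hn ha hb (hγ t ht) hw (hball (hγr t ht))).mul
      (HasDerivAt.conj_comp (hasDerivAt_calK_herm hn ha hb (hη t ht) hw
        (hball (hηr t ht))))).mul_const _

theorem exists_line_nhds {z : Cn n} (hz : z ∈ unitBall n) (v : Cn n) :
    ∃ s ∈ nhds (0 : ℝ), ∃ r < 1, ‖z‖ ≤ r ∧ ∀ t ∈ s, ‖z + t • v‖ ≤ r := by
  obtain ⟨r, hr1, hr2⟩ := exists_between (mem_ball_zero_iff.1 hz)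
  refine ⟨{t | ‖z + t • v‖ < r}, ?_, r, hr2, hr1.le, fun t ht ↦ le_of_lt ht⟩
  have : Continuous fun t : ℝ ↦ ‖z + t • v‖ := by fun_prop
  exact (isOpen_Iio.preimage this).mem_nhds (by simpa using hr1)

theorem hasDerivAt_line (z v : Cn n) (t : ℝ) : HasDerivAt (fun t : ℝ ↦ z + t • v) v t := by
  simpa using ((hasDerivAt_id t).smul_const v).const_add z

theorem memLp_deriv_calK_mul_herm (hn : 1 ≤ n) (ha : -1 < a) (hb : -(n : ℝ) < b) {z : Cn n}
    (hz : z ∈ unitBall n) (v : Cn n) :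
    MemLp (fun w ↦ deriv (calK n a b : ℂ → ℂ) (herm w z) * herm w v) 2 (mu n a b) := by
  have := isFiniteMeasure_mu hn ha hb
  obtain ⟨B, hB0, hB⟩ := exists_norm_le_of_continuousOn_disc
    (differentiableOn_deriv_calK hn ha hb).continuousOn (mem_ball_zero_iff.1 hz)
  refine MemLp.of_bound (aestronglyMeasurable_of_continuousOn
    ((continuousOn_deriv_calK_herm hn ha hb hz).mul (continuous_herm_left v).continuousOn))
    (B * ‖v‖) ?_
  filter_upwards [ae_mem_unitBall n a b] with w hw
  rw [norm_mul]
  exact mul_le_mul (hB _ (norm_herm_le_of_mem hw _)) (norm_herm_le_of_mem hw _) (norm_nonneg _) hB0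

theorem memLp_calK_herm (hn : 1 ≤ n) (ha : -1 < a) (hb : -(n : ℝ) < b) {z : Cn n}
    (hz : z ∈ unitBall n) (p : ENNReal) : MemLp (fun w ↦ calK n a b (herm w z)) p (mu n a b) := by
  have := isFiniteMeasure_mu hn ha hb
  obtain ⟨B, hB0, hB⟩ := exists_norm_le_of_continuousOn_disc
    (differentiableOn_calK hn ha hb).continuousOn (mem_ball_zero_iff.1 hz)
  refine MemLp.of_bound (aestronglyMeasurable_of_continuousOn
    (continuousOn_calK_herm hn ha hb hz)) B ?_
  filter_upwards [ae_mem_unitBall n a b] with w hw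
  exact hB _ (norm_herm_le_of_mem hw _)

/-- The inner product of a derivative of the kernel with the kernel. -/
theorem integral_deriv_calK_mul_conj_calK (hn : 1 ≤ n) (ha : -1 < a) (hb : -(n : ℝ) < b)
    {z z' : Cn n} (hz : z ∈ unitBall n) (hz' : z' ∈ unitBall n) (v : Cn n) :
    ∫ w, deriv (calK n a b : ℂ → ℂ) (herm w z) * herm w v * conj (calK n a b (herm w z'))
      ∂mu n a b = deriv (calK n a b : ℂ → ℂ) (herm z' z) * herm z' v := by
  have := isFiniteMeasure_mu hn ha hb
  obtain ⟨s, hs, r, hr, hzr, hsr⟩ := exists_line_nhds hz v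
  -- Differentiate the reproducing identity in `z` along the line `z + t • v`, with `z'` held fixed
  -- and `f = 1`.
  have h := (hasDerivAt_integral_calK_mul_conj_calK hn ha hb (r := max r ‖z'‖) (C := ‖v‖)
    (η := fun _ ↦ z') (η' := fun _ ↦ 0) hs (max_lt hr (mem_ball_zero_iff.1 hz'))
    (fun t _ ↦ hasDerivAt_line z v t)
    (fun _ _ ↦ le_rfl) (fun t ht ↦ (hsr t ht).trans (le_max_left _ _))
    (fun t _ ↦ hasDerivAt_const t z') (fun _ _ ↦ by simp) (fun _ _ ↦ le_max_right _ _)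
    (integrable_const (1 : ℂ))).2
  have h0 : ∀ w : Cn n, herm w 0 = 0 := fun w ↦ by simp [herm_eq_inner]
  simp only [zero_smul, add_zero, h0, mul_zero, map_zero, mul_one] at h
  refine h.unique (HasDerivAt.congr_of_eventuallyEq
    (f := fun t : ℝ ↦ calK n a b (herm z' (z + t • v))) ?_ ?_)
  · have := hasDerivAt_calK_herm hn ha hb (hasDerivAt_line z v 0) hz' (by simpa using hz)
    simpa using this
  · filter_upwards [hs] with t ht
    exact integral_calK_mul_conj_calK hn ha hb
      (mem_ball_zero_iff.2 ((hsr t ht).trans_lt hr)) hz'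

/-- The squared norm of a derivative of the kernel. -/
theorem integral_norm_sq_deriv_calK (hn : 1 ≤ n) (ha : -1 < a) (hb : -(n : ℝ) < b)
    {z : Cn n} (hz : z ∈ unitBall n) (v : Cn n) :
    ∫ w, ‖deriv (calK n a b : ℂ → ℂ) (herm w z) * herm w v‖ ^ 2 ∂mu n a b =
      calKDeriv₂ n a b (‖z‖ ^ 2) * ‖herm z v‖ ^ 2 + calKDeriv n a b (‖z‖ ^ 2) * ‖v‖ ^ 2 := by
  have := isFiniteMeasure_mu hn ha hb
  obtain ⟨s, hs, r, hr, hzr, hsr⟩ := exists_line_nhds hz v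
  have hLp := memLp_deriv_calK_mul_herm hn ha hb hz v
  have hi : Integrable (fun w ↦ conj (deriv (calK n a b : ℂ → ℂ) (herm w z) * herm w v))
      (mu n a b) := by
    have := (hLp.integrable one_le_two)
    exact (Complex.conjCLE : ℂ →L[ℝ] ℂ).integrable_comp this
  -- Taking `η = 0` makes the second kernel `𝒦(0) = 1`, so only one kernel moves. It is paired with
  -- the conjugate of the derivative at `z`; the previous lemma gives this pairing for every `t`,
  -- and it is differentiated at `t = 0`.
  have h := (hasDerivAt_integral_calK_mul_conj_calK hn ha hb (r := r) (C := ‖v‖)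
    (η := fun _ ↦ 0) (η' := fun _ ↦ 0) hs hr (fun t _ ↦ hasDerivAt_line z v t)
    (fun _ _ ↦ le_rfl) (fun t ht ↦ hsr t ht)
    (fun t _ ↦ hasDerivAt_const t 0) (fun _ _ ↦ by simp)
    (fun _ _ ↦ by simpa using (norm_nonneg z).trans hzr) hi).2
  have h0 : ∀ w : Cn n, herm w 0 = 0 := fun w ↦ by simp [herm_eq_inner]
  simp only [zero_smul, add_zero, h0, mul_zero, map_zero, mul_one, calK_zero, map_one] at h
  have hz2 : |‖z‖ ^ 2| < 1 := by
    rw [abs_of_nonneg (by positivity)]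
    exact pow_lt_one₀ (norm_nonneg _) (mem_ball_zero_iff.1 hz) two_ne_zero
  have h2 : HasDerivAt
      (fun t : ℝ ↦ conj (deriv (calK n a b : ℂ → ℂ) (herm (z + t • v) z) * herm (z + t • v) v))
      (conj (deriv (deriv (calK n a b : ℂ → ℂ)) (herm z z) * herm v z * herm z v +
        deriv (calK n a b : ℂ → ℂ) (herm z z) * herm v v)) 0 := by
    refine HasDerivAt.conj_comp ?_
    have e1 := hasDerivAt_herm_left (hasDerivAt_line z v 0) z
    have e2 := hasDerivAt_herm_left (hasDerivAt_line z v 0) v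
    have e3 := (hasDerivAt_deriv_calK hn ha hb
      (ξ := herm (z + (0 : ℝ) • v) z) (by simpa using norm_herm_lt_one hz hz)).comp (0 : ℝ) e1
    simpa using! e3.mul e2
  have h3 := h.unique (h2.congr_of_eventuallyEq (by
    filter_upwards [hs] with t ht
    rw [← integral_deriv_calK_mul_conj_calK hn ha hb hz
      (mem_ball_zero_iff.2 ((hsr t ht).trans_lt hr)), ← integral_conj]
    refine integral_congr_ae (.of_forall fun w ↦ ?_)
    simp
    ring))
  rw [herm_self, herm_self, ← ofReal_calKDeriv hn ha hb hz2, ← ofReal_calKDeriv₂ hn ha hb hz2,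
    mul_assoc, ← conj_herm z v, mul_comm (conj _), Complex.mul_conj'] at h3
  rw [← Complex.ofReal_inj, ← integral_complex_ofReal]
  simp only [Complex.mul_conj'] at h3
  simp only [map_add, map_mul, Complex.conj_ofReal, map_pow] at h3
  push_cast at h3 ⊢
  exact h3

/-! ### The complex Hessian of the potential -/

theorem abs_norm_sq_lt_one {z : Cn n} (hz : z ∈ unitBall n) : |‖z‖ ^ 2| < 1 := by
  rw [abs_of_nonneg (by positivity)]
  exact pow_lt_one₀ (norm_nonneg _) (mem_ball_zero_iff.1 hz) two_ne_zero

theorem calK_norm_sq_pos (hn : 1 ≤ n) (ha : -1 < a) (hb : -(n : ℝ) < b) {z : Cn n}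
    (hz : z ∈ unitBall n) : 0 < calK n a b (‖z‖ ^ 2) :=
  calK_real_pos hn ha hb (by positivity) (lt_of_abs_lt (abs_norm_sq_lt_one hz))

/-- The logarithmic derivative of `calK` on `(-1, 1)`. -/
noncomputable def calKLogDeriv (n : ℕ) (a b : ℝ) (x : ℝ) : ℝ := calKDeriv n a b x / calK n a b x

theorem hasFDerivAt_comp_norm_sq {g : ℝ → ℝ} {g' : ℝ} {z : Cn n}
    (hg : HasDerivAt g g' (‖z‖ ^ 2)) :
    HasFDerivAt (fun w : Cn n ↦ ((g (‖w‖ ^ 2) : ℝ) : ℂ))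
      (Complex.ofRealCLM.comp (g' • (2 • innerSL ℝ z))) z :=
  Complex.ofRealCLM.hasFDerivAt.comp z
    (hg.comp_hasFDerivAt z (hasStrictFDerivAt_norm_sq z).hasFDerivAt)

theorem real_inner_single (z : Cn n) (j : Fin n) (c : ℂ) :
    inner ℝ z (EuclideanSpace.single j c) = (conj (z j) * c).re := by
  rw [PiLp.inner_apply, Finset.sum_eq_single j]
  · simp [Complex.inner]
    ring
  · intro i _ hij
    simp [hij]
  · simp

theorem dzbar_psi (hn : 1 ≤ n) (ha : -1 < a) (hb : -(n : ℝ) < b) {z : Cn n}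
    (hz : z ∈ unitBall n) (k : Fin n) :
    dzbar k (fun w ↦ (psi n a b w : ℂ)) z = (calKLogDeriv n a b (‖z‖ ^ 2) : ℂ) * z k := by
  have h := hasFDerivAt_comp_norm_sq (z := z) ((hasDerivAt_calK_real hn ha hb
    (abs_norm_sq_lt_one hz)).log (calK_norm_sq_pos hn ha hb hz).ne')
  rw [dzbar, show (fun w ↦ (psi n a b w : ℂ)) =
    fun w : Cn n ↦ ((Real.log (calK n a b (‖w‖ ^ 2)) : ℝ) : ℂ) from rfl, h.fderiv]
  simp only [ContinuousLinearMap.comp_apply, smul_apply, innerSL_apply_apply,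
    real_inner_single, Complex.ofRealCLM_apply, calKLogDeriv]
  apply Complex.ext <;> simp <;> ring

theorem hasDerivAt_calKLogDeriv (hn : 1 ≤ n) (ha : -1 < a) (hb : -(n : ℝ) < b) {x : ℝ}
    (h0 : 0 ≤ x) (h1 : x < 1) :
    HasDerivAt (calKLogDeriv n a b) ((calKDeriv₂ n a b x * calK n a b x -
      calKDeriv n a b x * calKDeriv n a b x) / calK n a b x ^ 2) x := by
  have hx : |x| < 1 := abs_lt.2 ⟨by linarith, h1⟩
  exact (hasDerivAt_calKDeriv hn ha hb hx).div (hasDerivAt_calK_real hn ha hb hx)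
    (calK_real_pos hn ha hb h0 h1).ne'

/-- The chain rule for a radial function `g(|z|²)`: the entry is `g'' conj(z_j) z_k + g' δ_jk`, here
with `g = log 𝒦`. -/
theorem hess_apply (hn : 1 ≤ n) (ha : -1 < a) (hb : -(n : ℝ) < b) {z : Cn n}
    (hz : z ∈ unitBall n) (j k : Fin n) :
    hess n a b z j k = (((calKDeriv₂ n a b (‖z‖ ^ 2) * calK n a b (‖z‖ ^ 2) -
      calKDeriv n a b (‖z‖ ^ 2) * calKDeriv n a b (‖z‖ ^ 2)) / calK n a b (‖z‖ ^ 2) ^ 2 : ℝ) : ℂ) *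
        conj (z j) * z k + (calKLogDeriv n a b (‖z‖ ^ 2) : ℂ) * (if j = k then 1 else 0) := by
  have h1 := hasFDerivAt_comp_norm_sq (z := z) (hasDerivAt_calKLogDeriv hn ha hb
    (by positivity) (lt_of_abs_lt (abs_norm_sq_lt_one hz)))
  have h2 : HasFDerivAt (fun w : Cn n ↦ w k) (PiLp.proj 2 (fun _ : Fin n ↦ ℂ) k : Cn n →L[ℝ] ℂ) z :=
    (PiLp.proj 2 (fun _ : Fin n ↦ ℂ) k : Cn n →L[ℝ] ℂ).hasFDerivAt
  have h := (h1.mul h2).congr_of_eventuallyEq (f₁ := dzbar k fun w ↦ (psi n a b w : ℂ)) (by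
    filter_upwards [Metric.isOpen_ball.mem_nhds hz] with w hw
    exact dzbar_psi hn ha hb hw k)
  have hs : ∀ c : ℂ, (EuclideanSpace.single j c : Cn n) k = if j = k then c else 0 := fun c ↦ by
    simp [eq_comm]
  rw [hess, Matrix.of_apply, dz, h.fderiv]
  simp only [ContinuousLinearMap.comp_apply, smul_apply, innerSL_apply_apply,
    real_inner_single, Complex.ofRealCLM_apply, add_apply,
    PiLp.proj_apply, hs]
  generalize (calKDeriv₂ n a b (‖z‖ ^ 2) * calK n a b (‖z‖ ^ 2) -
      calKDeriv n a b (‖z‖ ^ 2) * calKDeriv n a b (‖z‖ ^ 2)) / calK n a b (‖z‖ ^ 2) ^ 2 = M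
  split_ifs <;> apply Complex.ext <;> simp <;> ring

/-- The Hermitian form of the complex Hessian of `psi`. -/
theorem hessForm_eq (hn : 1 ≤ n) (ha : -1 < a) (hb : -(n : ℝ) < b) {z : Cn n}
    (hz : z ∈ unitBall n) (ξ : Cn n) :
    hessForm n a b z ξ = (calKDeriv₂ n a b (‖z‖ ^ 2) * calK n a b (‖z‖ ^ 2) -
      calKDeriv n a b (‖z‖ ^ 2) * calKDeriv n a b (‖z‖ ^ 2)) / calK n a b (‖z‖ ^ 2) ^ 2 *
        ‖herm z ξ‖ ^ 2 + calKLogDeriv n a b (‖z‖ ^ 2) * ‖ξ‖ ^ 2 := by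
  rw [hessForm]
  simp only [hess_apply hn ha hb hz]
  generalize (calKDeriv₂ n a b (‖z‖ ^ 2) * calK n a b (‖z‖ ^ 2) -
      calKDeriv n a b (‖z‖ ^ 2) * calKDeriv n a b (‖z‖ ^ 2)) / calK n a b (‖z‖ ^ 2) ^ 2 = M
  have e1 : ((‖herm z ξ‖ ^ 2 : ℝ) : ℂ) = ∑ j, ∑ k, conj (z j) * ξ j * (z k * conj (ξ k)) := by
    push_cast
    rw [← Complex.conj_mul', herm, map_sum, Finset.sum_mul_sum]
    simp
  have e2 : ((‖ξ‖ ^ 2 : ℝ) : ℂ) = ∑ j, ∑ k, (if j = k then 1 else 0) * (ξ j * conj (ξ k)) := by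
    rw [← herm_self, herm]
    simp
  rw [← Complex.ofReal_re (_ + _)]
  congr 1
  rw [Complex.ofReal_add, Complex.ofReal_mul, Complex.ofReal_mul, e1, e2, Finset.mul_sum,
    Finset.mul_sum, ← Finset.sum_add_distrib]
  refine Finset.sum_congr rfl fun j _ ↦ ?_
  rw [Finset.mul_sum, Finset.mul_sum, ← Finset.sum_add_distrib]
  refine Finset.sum_congr rfl fun k _ ↦ ?_
  ring

/-! ### Mean, variance and the metric as norms in `L²` -/

theorem integral_norm_sq_calK (hn : 1 ≤ n) (ha : -1 < a) (hb : -(n : ℝ) < b) {z : Cn n}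
    (hz : z ∈ unitBall n) :
    ∫ w, ‖calK n a b (herm w z)‖ ^ 2 ∂mu n a b = calK n a b (‖z‖ ^ 2) := by
  have h := integral_calK_mul_conj_calK hn ha hb hz hz
  simp only [Complex.mul_conj'] at h
  rw [herm_self, ← ofReal_calK] at h
  rw [← Complex.ofReal_inj, ← h, ← integral_complex_ofReal]
  push_cast
  rfl

theorem berezin_eq_smul_integral {𝕂 : Type} [NormedAddCommGroup 𝕂] [NormedSpace ℝ 𝕂]
    (f : Cn n → 𝕂) (z : Cn n) : berezin n a b f z = (calK n a b (‖z‖ ^ 2))⁻¹ •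
      ∫ w, ‖calK n a b (herm w z)‖ ^ 2 • f w ∂mu n a b := by
  rw [berezin, ← integral_smul]
  refine integral_congr_ae (.of_forall fun w ↦ ?_)
  simp only [smul_smul]
  congr 1
  ring

theorem integrable_norm_sq_calK_smul (hn : 1 ≤ n) (ha : -1 < a) (hb : -(n : ℝ) < b)
    {𝕂 : Type} [NormedAddCommGroup 𝕂] [NormedSpace ℝ 𝕂] {f : Cn n → 𝕂}
    (hf : Integrable f (mu n a b)) {z : Cn n} (hz : z ∈ unitBall n) :
    Integrable (fun w ↦ ‖calK n a b (herm w z)‖ ^ 2 • f w) (mu n a b) := by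
  obtain ⟨A, hA0, hA⟩ := exists_norm_le_of_continuousOn_disc
    (differentiableOn_calK hn ha hb).continuousOn (mem_ball_zero_iff.1 hz)
  refine hf.bdd_smul (A ^ 2) ((memLp_calK_herm hn ha hb hz 1).aestronglyMeasurable.norm.pow 2) ?_
  filter_upwards [ae_mem_unitBall n a b] with w hw
  rw [norm_pow, norm_norm]
  gcongr
  exact hA _ (norm_herm_le_of_mem hw z)

/-- Expansion of the squared `L²` norm of `g - α u`. -/
theorem integral_norm_sub_mul_sq {Ω : Type*} [MeasurableSpace Ω] {μ : Measure Ω} {g u : Ω → ℂ}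
    (hg : MemLp g 2 μ) (hu : MemLp u 2 μ) (α : ℂ) :
    ∫ w, ‖g w - α * u w‖ ^ 2 ∂μ = ∫ w, ‖g w‖ ^ 2 ∂μ -
      2 * (conj α * ∫ w, g w * conj (u w) ∂μ).re + ‖α‖ ^ 2 * ∫ w, ‖u w‖ ^ 2 ∂μ := by
  have hcross : Integrable (fun w ↦ conj α * (g w * conj (u w))) μ :=
    (hg.integrable_mul hu.star).const_mul (conj α)
  have hpt : ∀ w, ‖g w - α * u w‖ ^ 2 =
      ‖g w‖ ^ 2 - 2 * (conj α * (g w * conj (u w))).re + ‖α‖ ^ 2 * ‖u w‖ ^ 2 := fun w ↦ by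
    simp only [← Complex.normSq_eq_norm_sq, Complex.normSq_apply, Complex.sub_re, Complex.sub_im,
      Complex.mul_re, Complex.mul_im, Complex.conj_re, Complex.conj_im]
    ring
  have hi1 := hg.integrable_norm_pow two_ne_zero
  have hi2 : Integrable (fun w ↦ 2 * (conj α * (g w * conj (u w))).re) μ :=
    hcross.re.const_mul 2
  have hi3 := (hu.integrable_norm_pow two_ne_zero).const_mul (‖α‖ ^ 2)
  have hre := integral_re hcross
  simp only [RCLike.re_to_complex] at hre
  simp only [hpt]
  rw [integral_add (f := fun w ↦ ‖g w‖ ^ 2 - 2 * (conj α * (g w * conj (u w))).re)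
    (hi1.sub hi2) hi3, integral_sub hi1 hi2, integral_const_mul, integral_const_mul, hre,
    integral_const_mul]

/-- The mean oscillation as a variance for the probability measure of density
`‖calK (herm w z)‖² / calK ‖z‖²`. -/
theorem integral_norm_sq_calK_mul_norm_sub (hn : 1 ≤ n) (ha : -1 < a) (hb : -(n : ℝ) < b)
    {f : Cn n → ℂ} (hf : MemLp f 2 (mu n a b)) {z : Cn n} (hz : z ∈ unitBall n) :
    ∫ w, ‖calK n a b (herm w z) * (f w - berezin n a b f z)‖ ^ 2 ∂mu n a b =
      calK n a b (‖z‖ ^ 2) * meanOsc n a b f z ^ 2 := by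
  have := isFiniteMeasure_mu hn ha hb
  have hN := calK_norm_sq_pos hn ha hb hz
  have hu := memLp_calK_herm hn ha hb hz
  have hg : MemLp (fun w ↦ calK n a b (herm w z) * f w) 2 (mu n a b) := hf.mul (hu ⊤)
  have hvar : ∫ w, ‖calK n a b (herm w z) * (f w - berezin n a b f z)‖ ^ 2 ∂mu n a b =
      calK n a b (‖z‖ ^ 2) * (berezin n a b (fun w ↦ ‖f w‖ ^ 2) z - ‖berezin n a b f z‖ ^ 2) := by
    have h := integral_norm_sub_mul_sq hg (hu 2) (berezin n a b f z)
    have e1 : ∀ w, calK n a b (herm w z) * (f w - berezin n a b f z) =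
        calK n a b (herm w z) * f w - berezin n a b f z * calK n a b (herm w z) :=
      fun w ↦ by ring
    have e2 : ∫ w, calK n a b (herm w z) * f w * conj (calK n a b (herm w z)) ∂mu n a b =
        ((calK n a b (‖z‖ ^ 2) : ℝ) : ℂ) * berezin n a b f z := by
      rw [berezin_eq_smul_integral, ← Complex.real_smul, smul_inv_smul₀ hN.ne']
      refine integral_congr_ae (.of_forall fun w ↦ ?_)
      simp only [Complex.real_smul, Complex.ofReal_pow, ← Complex.mul_conj']
      ring
    have e3 : ∫ w, ‖calK n a b (herm w z) * f w‖ ^ 2 ∂mu n a b =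
        calK n a b (‖z‖ ^ 2) * berezin n a b (fun w ↦ ‖f w‖ ^ 2) z := by
      rw [berezin_eq_smul_integral, smul_eq_mul, mul_inv_cancel_left₀ hN.ne']
      simp only [norm_mul, mul_pow, smul_eq_mul]
    have e4 : conj (berezin n a b f z) * (((calK n a b (‖z‖ ^ 2) : ℝ) : ℂ) * berezin n a b f z) =
        ((calK n a b (‖z‖ ^ 2) * ‖berezin n a b f z‖ ^ 2 : ℝ) : ℂ) := by
      rw [Complex.ofReal_mul, Complex.ofReal_pow, ← Complex.conj_mul']
      ring
    simp only [e1]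
    rw [h, e2, e3, e4, Complex.ofReal_re, integral_norm_sq_calK hn ha hb hz]
    ring
  rw [hvar, meanOsc, Real.sq_sqrt]
  -- `Real.sqrt` truncates negative arguments to zero. Here the radicand is nonnegative because
  -- `𝒦(|z|²)` times it is the integral of a square.
  have h0 : 0 ≤ ∫ w, ‖calK n a b (herm w z) * (f w - berezin n a b f z)‖ ^ 2 ∂mu n a b :=
    integral_nonneg fun w ↦ by positivity
  rw [hvar] at h0
  exact nonneg_of_mul_nonneg_right h0 hN

/-- The squared distance of a derivative of the kernel to the line spanned by the kernel. -/
theorem integral_norm_sq_deriv_calK_sub (hn : 1 ≤ n) (ha : -1 < a) (hb : -(n : ℝ) < b)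
    {z : Cn n} (hz : z ∈ unitBall n) (v : Cn n) {α : ℂ}
    (hα : α * ((calK n a b (‖z‖ ^ 2) : ℝ) : ℂ) =
      deriv (calK n a b : ℂ → ℂ) (herm z z) * herm z v) :
    ∫ w, ‖deriv (calK n a b : ℂ → ℂ) (herm w z) * herm w v - α * calK n a b (herm w z)‖ ^ 2
      ∂mu n a b = calK n a b (‖z‖ ^ 2) * hessForm n a b z v := by
  have hN := calK_norm_sq_pos hn ha hb hz
  have h := integral_norm_sub_mul_sq (memLp_deriv_calK_mul_herm hn ha hb hz v)
    (memLp_calK_herm hn ha hb hz 2) α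
  -- Since `α N` is the inner product of the derivative with the kernel, the cross term is `2 |α|²
  -- N` and the total is `‖u'‖² - |α|² N`.
  have e : conj α * (α * ((calK n a b (‖z‖ ^ 2) : ℝ) : ℂ)) =
      ((‖α‖ ^ 2 * calK n a b (‖z‖ ^ 2) : ℝ) : ℂ) := by
    rw [← mul_assoc, Complex.conj_mul', Complex.ofReal_mul, Complex.ofReal_pow]
  rw [integral_deriv_calK_mul_conj_calK hn ha hb hz hz v, ← hα, e, Complex.ofReal_re,
    integral_norm_sq_deriv_calK hn ha hb hz v, integral_norm_sq_calK hn ha hb hz] at h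
  rw [h, hessForm_eq hn ha hb hz, calKLogDeriv]
  -- The subtracted square supplies the term `-(𝒦')² |⟨z,v⟩|²` in the Hessian of `log 𝒦`.
  have hαn : ‖α‖ ^ 2 * calK n a b (‖z‖ ^ 2) ^ 2 =
      calKDeriv n a b (‖z‖ ^ 2) ^ 2 * ‖herm z v‖ ^ 2 := by
    rw [herm_self, ← ofReal_calKDeriv hn ha hb (abs_norm_sq_lt_one hz)] at hα
    have := congrArg (fun x : ℂ ↦ ‖x‖ ^ 2) hα
    simpa [mul_pow] using this
  field_simp
  linear_combination (-1 : ℝ) * hαn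

/-! ### The infinitesimal Lipschitz estimate -/

/-- The derivative of the Berezin transform along a curve. -/
theorem exists_hasDerivAt_berezin (hn : 1 ≤ n) (ha : -1 < a) (hb : -(n : ℝ) < b)
    {f : Cn n → ℂ} (hf : MemLp f 2 (mu n a b)) {γ γ' : ℝ → Cn n} {s : Set ℝ} {t₀ r C : ℝ}
    (hs : s ∈ nhds t₀) (hr : r < 1) (hγ : ∀ t ∈ s, HasDerivAt γ (γ' t) t)
    (hγ' : ∀ t ∈ s, ‖γ' t‖ ≤ C) (hγr : ∀ t ∈ s, ‖γ t‖ ≤ r) :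
    ∃ D, HasDerivAt (fun t ↦ berezin n a b f (γ t)) D t₀ ∧
      ‖D‖ ≤ 2 * meanOsc n a b f (γ t₀) * Real.sqrt (hessForm n a b (γ t₀) (γ' t₀)) := by
  have := isFiniteMeasure_mu hn ha hb
  have hfi := hf.integrable one_le_two
  have hball : ∀ t ∈ s, γ t ∈ unitBall n := fun t ht ↦
    mem_ball_zero_iff.2 ((hγr t ht).trans_lt hr)
  have hz := hball t₀ (mem_of_mem_nhds hs)
  obtain ⟨hif, hdf⟩ := hasDerivAt_integral_calK_mul_conj_calK hn ha hb hs hr hγ hγ' hγr hγ hγ' hγr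
    hfi
  obtain ⟨hi1, hd1⟩ := hasDerivAt_integral_calK_mul_conj_calK hn ha hb hs hr hγ hγ' hγr hγ hγ' hγr
    (integrable_const (1 : ℂ))
  -- The normalising factor is itself such an integral with `f = 1`, so one differentiation lemma
  -- serves numerator and denominator.
  have hB : ∀ t ∈ s, berezin n a b f (γ t) =
      (∫ w, calK n a b (herm w (γ t)) * conj (calK n a b (herm w (γ t))) * f w ∂mu n a b) /
      (∫ w, calK n a b (herm w (γ t)) * conj (calK n a b (herm w (γ t))) * 1 ∂mu n a b) := by
    intro t ht
    simp only [mul_one]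
    rw [integral_calK_mul_conj_calK hn ha hb (hball t ht) (hball t ht), herm_self, ← ofReal_calK,
      berezin_eq_smul_integral, Complex.real_smul, Complex.ofReal_inv, div_eq_inv_mul]
    congr 1
    refine integral_congr_ae (.of_forall fun w ↦ ?_)
    simp only [Complex.mul_conj', Complex.real_smul]
    push_cast
    rfl
  have hN := calK_norm_sq_pos hn ha hb hz
  have hNc : ((calK n a b (‖γ t₀‖ ^ 2) : ℝ) : ℂ) ≠ 0 := by exact_mod_cast hN.ne'
  have hI1 : ∫ w, calK n a b (herm w (γ t₀)) * conj (calK n a b (herm w (γ t₀))) * 1 ∂mu n a b =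
      (calK n a b (‖γ t₀‖ ^ 2) : ℝ) := by
    simp only [mul_one]
    rw [integral_calK_mul_conj_calK hn ha hb hz hz, herm_self, ← ofReal_calK]
  have hd := (hdf.div hd1 (by rw [hI1]; exact hNc)).congr_of_eventuallyEq
    (f₁ := fun t ↦ berezin n a b f (γ t)) (by filter_upwards [hs] with t ht using hB t ht)
  refine ⟨_, hd, ?_⟩
  have hBt := hB t₀ (mem_of_mem_nhds hs)
  rw [hI1] at hBt ⊢
  have hvar := integral_norm_sq_calK_mul_norm_sub hn ha hb hf hz
  set z := γ t₀ with hzdef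
  set v := γ' t₀ with hvdef
  set N : ℝ := calK n a b (‖z‖ ^ 2) with hNdef
  set c := berezin n a b f z with hcdef
  set p : ℂ := deriv (calK n a b : ℂ → ℂ) (herm z z) * herm z v with hpdef
  have hp := integral_deriv_calK_mul_conj_calK hn ha hb hz hz v
  have hdist := integral_norm_sq_deriv_calK_sub hn ha hb hz v (α := p / N) (by
    rw [← hNdef, div_mul_cancel₀ _ hNc])
  have hiD := memLp_deriv_calK_mul_herm hn ha hb hz v
  have hiu := memLp_calK_herm hn ha hb hz
  set u := fun w ↦ calK n a b (herm w z) with hudef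
  set u' := fun w ↦ deriv (calK n a b : ℂ → ℂ) (herm w z) * herm w v with hu'def
  set e := fun w ↦ u' w - p / N * u w with hedef
  have hcross : Integrable (fun w ↦ u' w * conj (u w)) (mu n a b) :=
    hiD.integrable_mul (hiu 2).star
  have he : MemLp e 2 (mu n a b) := hiD.sub ((hiu 2).const_mul _)
  have hg : MemLp (fun w ↦ u w * (f w - c)) 2 (mu n a b) :=
    (hf.sub (memLp_const c)).mul (hiu ⊤)
  have hcross' : Integrable (fun w ↦ u w * conj (u' w)) (mu n a b) :=
    (hiu 2).integrable_mul hiD.star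
  have hcross'_int : ∫ w, u w * conj (u' w) ∂mu n a b = conj p := by
    rw [hpdef, ← hp, ← integral_conj]
    refine integral_congr_ae (.of_forall fun w ↦ ?_)
    simp [hudef, hu'def]
    ring
  have hQ1 : ∫ w, (u' w * conj (u w) + u w * conj (u' w)) * 1 ∂mu n a b = p + conj p := by
    simp only [mul_one]
    rw [integral_add hcross hcross', hcross'_int]
    exact congrArg (· + conj p) hp
  have huf : Integrable (fun w ↦ u w * conj (u w) * f w) (mu n a b) := by
    have := integrable_norm_sq_calK_smul hn ha hb hfi hz
    simpa only [Complex.real_smul, Complex.ofReal_pow, ← Complex.mul_conj'] using this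
  have hu1 : Integrable (fun w ↦ u w * conj (u w) * 1) (mu n a b) := by
    have := integrable_norm_sq_calK_smul hn ha hb (integrable_const (1 : ℂ)) hz
    simpa only [Complex.real_smul, Complex.ofReal_pow, ← Complex.mul_conj'] using this
  have hIuf : ∫ w, u w * conj (u w) * f w ∂mu n a b = c * N := by
    rw [hBt, div_mul_cancel₀ _ hNc]
  -- Replacing `u'` by `e` subtracts `((p + conj p) / N) |u|² (f - c)`, whose integral vanishes
  -- because `c` is the mean of `f`.
  have hpt : ∀ w, (e w * conj (u w) + u w * conj (e w)) * (f w - c) =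
      ((u' w * conj (u w) + u w * conj (u' w)) * f w -
        c * ((u' w * conj (u w) + u w * conj (u' w)) * 1)) -
      ((p + conj p) / N * (u w * conj (u w) * f w) -
        c * ((p + conj p) / N) * (u w * conj (u w) * 1)) := fun w ↦ by
    simp only [hedef, map_sub, map_mul, map_div₀, Complex.conj_ofReal]
    ring
  have hmain : ∫ w, (e w * conj (u w) + u w * conj (e w)) * (f w - c) ∂mu n a b =
      (∫ w, (u' w * conj (u w) + u w * conj (u' w)) * f w ∂mu n a b) - c * (p + conj p) := by
    simp only [hpt]
    rw [integral_sub
      (f := fun w ↦ (u' w * conj (u w) + u w * conj (u' w)) * f w -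
        c * ((u' w * conj (u w) + u w * conj (u' w)) * 1))
      (g := fun w ↦ (p + conj p) / N * (u w * conj (u w) * f w) -
        c * ((p + conj p) / N) * (u w * conj (u w) * 1))
      (hif.sub (hi1.const_mul c)) ((huf.const_mul _).sub (hu1.const_mul _)),
      integral_sub hif (hi1.const_mul c), integral_sub (huf.const_mul _) (hu1.const_mul _),
      integral_const_mul, integral_const_mul, integral_const_mul, hQ1, hIuf, hI1]
    ring
  have hCS : ∫ w, ‖e w‖ * ‖u w * (f w - c)‖ ∂mu n a b ≤
      N * (meanOsc n a b f z * Real.sqrt (hessForm n a b z v)) := by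
    have h2 : ENNReal.ofReal 2 = 2 := by simp
    have h := integral_mul_norm_le_Lp_mul_Lq (μ := mu n a b) (f := e)
      (g := fun w ↦ u w * (f w - c)) Real.HolderConjugate.two_two
      (by rwa [h2]) (by rwa [h2])
    simp only [Real.rpow_two, ← Real.sqrt_eq_rpow] at h
    rw [hvar, hdist, Real.sqrt_mul hN.le, Real.sqrt_mul hN.le,
      Real.sqrt_sq (show 0 ≤ meanOsc n a b f z from Real.sqrt_nonneg _)] at h
    refine h.trans (le_of_eq ?_)
    linear_combination
      (meanOsc n a b f z * Real.sqrt (hessForm n a b z v)) * Real.mul_self_sqrt hN.le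
  have hbound : ‖∫ w, (e w * conj (u w) + u w * conj (e w)) * (f w - c) ∂mu n a b‖ ≤
      2 * (N * (meanOsc n a b f z * Real.sqrt (hessForm n a b z v))) := by
    refine (norm_integral_le_of_norm_le ((he.norm.integrable_mul hg.norm).const_mul 2)
      (.of_forall fun w ↦ ?_)).trans ?_
    · rw [norm_mul]
      refine (mul_le_mul_of_nonneg_right (norm_add_le _ _) (norm_nonneg _)).trans (le_of_eq ?_)
      simp only [Pi.mul_apply, norm_mul, RCLike.norm_conj]
      ring
    · rw [integral_const_mul]
      exact mul_le_mul_of_nonneg_left hCS two_pos.le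
  -- This is the expression given by the quotient rule; by `hmain` it collapses to one integral
  -- divided by `N`.
  change ‖((∫ w, (u' w * conj (u w) + u w * conj (u' w)) * f w ∂mu n a b) * N -
    (∫ w, u w * conj (u w) * f w ∂mu n a b) *
      ∫ w, (u' w * conj (u w) + u w * conj (u' w)) * 1 ∂mu n a b) / (N : ℂ) ^ 2‖ ≤ _
  rw [hQ1, hIuf, eq_add_of_sub_eq hmain.symm]
  have hD : (((∫ w, (e w * conj (u w) + u w * conj (e w)) * (f w - c) ∂mu n a b) +
      c * (p + conj p)) * N - c * N * (p + conj p)) / (N : ℂ) ^ 2 =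
      (∫ w, (e w * conj (u w) + u w * conj (e w)) * (f w - c) ∂mu n a b) / N := by
    field_simp
    ring
  rw [hD, norm_div, Complex.norm_real, Real.norm_of_nonneg hN.le, div_le_iff₀ hN]
  exact hbound.trans (le_of_eq (by ring))

/-! ### From the infinitesimal estimate to the distance -/

theorem meanOsc_le_bmoNorm {f : Cn n → ℂ} (hf : IsBMO n a b f) {z : Cn n} (hz : z ∈ unitBall n) :
    meanOsc n a b f z ≤ bmoNorm n a b f :=
  le_csSup hf.bddAbove ⟨z, hz, rfl⟩

theorem bmoNorm_nonneg (n : ℕ) (a b : ℝ) (f : Cn n → ℂ) : 0 ≤ bmoNorm n a b f :=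
  Real.sSup_nonneg (by rintro _ ⟨z, -, rfl⟩; exact Real.sqrt_nonneg _)

/-- The Berezin transform of an integrable function is continuous on the ball. -/
theorem continuousOn_berezin (hn : 1 ≤ n) (ha : -1 < a) (hb : -(n : ℝ) < b) {f : Cn n → ℂ}
    (hf : Integrable f (mu n a b)) : ContinuousOn (berezin n a b f) (unitBall n) := by
  intro z hz
  refine ContinuousAt.continuousWithinAt ?_
  obtain ⟨r, hr1, hr2⟩ := exists_between (mem_ball_zero_iff.1 hz)
  obtain ⟨A, hA0, hA⟩ := exists_norm_le_of_continuousOn_disc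
    (differentiableOn_calK hn ha hb).continuousOn hr2
  have hnhds : ∀ᶠ x : Cn n in nhds z, ‖x‖ < r :=
    continuous_norm.continuousAt.eventually (gt_mem_nhds hr1)
  have hK : ContinuousAt (fun x : Cn n ↦ (calK n a b (‖x‖ ^ 2) : ℝ)) z :=
    (hasDerivAt_calK_real hn ha hb (abs_norm_sq_lt_one hz)).continuousAt.comp
      (f := fun x : Cn n ↦ ‖x‖ ^ 2) (by fun_prop)
  rw [show berezin n a b f = fun x ↦ (calK n a b (‖x‖ ^ 2))⁻¹ •
    ∫ w, ‖calK n a b (herm w x)‖ ^ 2 • f w ∂mu n a b from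
      funext fun x ↦ berezin_eq_smul_integral f x]
  refine (hK.inv₀ (calK_norm_sq_pos hn ha hb hz).ne').smul ?_
  refine continuousAt_of_dominated (bound := fun w ↦ A ^ 2 * ‖f w‖) ?_ ?_ (hf.norm.const_mul _) ?_
  · filter_upwards [hnhds] with x hx
    exact (integrable_norm_sq_calK_smul hn ha hb hf
      (mem_ball_zero_iff.2 (hx.trans hr2))).aestronglyMeasurable
  · filter_upwards [hnhds] with x hx
    filter_upwards [ae_mem_unitBall n a b] with w hw
    rw [norm_smul, norm_pow, norm_norm]
    gcongr
    exact hA _ ((norm_herm_le_of_mem hw x).trans hx.le)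
  · filter_upwards [ae_mem_unitBall n a b] with w hw
    have h1 : ContinuousAt (fun x ↦ herm w x) z := by
      simp only [herm_eq_inner]
      fun_prop
    have h2 : ContinuousAt (fun x ↦ calK n a b (herm w x)) z :=
      (hasDerivAt_calK hn ha hb (norm_herm_lt_one hw hz)).continuousAt.comp
        (f := fun x ↦ herm w x) h1
    exact (h2.norm.pow 2).smul continuousAt_const

theorem continuousOn_hessForm_comp (hn : 1 ≤ n) (ha : -1 < a) (hb : -(n : ℝ) < b)
    {γ v : ℝ → Cn n} {s : Set ℝ} (hγ : ContinuousOn γ s) (hv : ContinuousOn v s)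
    (hball : ∀ t ∈ s, γ t ∈ unitBall n) :
    ContinuousOn (fun t ↦ hessForm n a b (γ t) (v t)) s := by
  have hx : ContinuousOn (fun t ↦ ‖γ t‖ ^ 2) s := hγ.norm.pow 2
  have hmaps : MapsTo (fun t ↦ ‖γ t‖ ^ 2) s {x : ℝ | |x| < 1} :=
    fun t ht ↦ abs_norm_sq_lt_one (hball t ht)
  have h0 : ContinuousOn (fun t ↦ (calK n a b (‖γ t‖ ^ 2) : ℝ)) s :=
    ContinuousOn.comp (g := (calK n a b : ℝ → ℝ)) (t := {x : ℝ | |x| < 1})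
      (fun x hx ↦ (hasDerivAt_calK_real hn ha hb hx).continuousAt.continuousWithinAt) hx hmaps
  have h1 : ContinuousOn (fun t ↦ calKDeriv n a b (‖γ t‖ ^ 2)) s :=
    ContinuousOn.comp (g := calKDeriv n a b) (t := {x : ℝ | |x| < 1})
      (fun x hx ↦ (hasDerivAt_calKDeriv hn ha hb hx).continuousAt.continuousWithinAt) hx hmaps
  have h2 : ContinuousOn (fun t ↦ calKDeriv₂ n a b (‖γ t‖ ^ 2)) s :=
    (continuousOn_calKDeriv₂ hn ha hb).comp hx hmaps
  have hne : ∀ t ∈ s, (calK n a b (‖γ t‖ ^ 2) : ℝ) ≠ 0 := fun t ht ↦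
    (calK_norm_sq_pos hn ha hb (hball t ht)).ne'
  have hherm : ContinuousOn (fun t ↦ herm (γ t) (v t)) s := by
    simp only [herm_eq_inner]
    exact hv.inner hγ
  refine ContinuousOn.congr ?_ fun t ht ↦ hessForm_eq hn ha hb (hball t ht) (v t)
  exact ((((h2.mul h0).sub (h1.mul h1)).div (h0.pow 2)
    fun t ht ↦ pow_ne_zero 2 (hne t ht)).mul (hherm.norm.pow 2)).add
      ((h1.div h0 hne).mul (hv.norm.pow 2))

/-- A norm version of the mean value inequality with an integrable bound on the derivative. -/
theorem norm_sub_le_integral_of_norm_deriv_le {g : ℝ → ℂ} {φ : ℝ → ℝ} {c d : ℝ} (hcd : c ≤ d)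
    (hg : ContinuousOn g (Icc c d)) (hφ : IntegrableOn φ (Icc c d))
    (hg' : ∀ t ∈ Ioo c d, ∃ D, HasDerivAt g D t ∧ ‖D‖ ≤ φ t) :
    ‖g d - g c‖ ≤ ∫ t in c..d, φ t := by
  choose! D hD hDφ using hg'
  set u := g d - g c with hu
  -- The real inequality is applied to `Re(conj u · g)`, whose increment is `‖u‖²`; one factor `‖u‖`
  -- is cancelled afterwards, the case `u = 0` being separate.
  have h := intervalIntegral.sub_le_integral_of_hasDeriv_right_of_le (a := c) (b := d)
    (g := fun t ↦ (conj u * g t).re) (g' := fun t ↦ (conj u * D t).re) (φ := fun t ↦ ‖u‖ * φ t)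
    hcd (Complex.continuous_re.comp_continuousOn (continuousOn_const.mul hg))
    (fun t ht ↦ (Complex.reCLM.hasFDerivAt.comp_hasDerivAt t
      ((hD t ht).const_mul (conj u))).hasDerivWithinAt)
    (hφ.const_mul _) fun t ht ↦ by
      refine (Complex.re_le_norm _).trans ?_
      rw [norm_mul, RCLike.norm_conj]
      exact mul_le_mul_of_nonneg_left (hDφ t ht) (norm_nonneg _)
  rw [← Complex.sub_re, ← mul_sub, ← hu, Complex.conj_mul', ← Complex.ofReal_pow,
    Complex.ofReal_re, intervalIntegral.integral_const_mul, sq] at h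
  rcases (norm_nonneg u).eq_or_lt with h0 | h0
  · rw [← h0, intervalIntegral.integral_of_le hcd, integral_Ioc_eq_integral_Ioo]
    exact setIntegral_nonneg measurableSet_Ioo fun t ht ↦ (norm_nonneg _).trans (hDφ t ht)
  · exact le_of_mul_le_mul_left h h0

/-- The Lipschitz estimate along one smooth piece of a curve. -/
theorem norm_berezin_sub_le_of_contDiffOn (hn : 1 ≤ n) (ha : -1 < a) (hb : -(n : ℝ) < b)
    {f : Cn n → ℂ} (hf : IsBMO n a b f) {γ : ℝ → Cn n} {c d : ℝ} (hcd : c < d)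
    (hγ : ContDiffOn ℝ ∞ γ (Icc c d)) (hball : ∀ t ∈ Icc c d, γ t ∈ unitBall n) :
    IntervalIntegrable (fun t ↦ Real.sqrt (hessForm n a b (γ t) (deriv γ t))) volume c d ∧
      ‖berezin n a b f (γ d) - berezin n a b f (γ c)‖ ≤ ∫ t in c..d,
        2 * bmoNorm n a b f * Real.sqrt (hessForm n a b (γ t) (deriv γ t)) := by
  have := isFiniteMeasure_mu hn ha hb
  set v := derivWithin γ (Icc c d) with hv
  have hvc : ContinuousOn v (Icc c d) :=
    hγ.continuousOn_derivWithin (uniqueDiffOn_Icc hcd) (by simp)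
  have hderiv : ∀ t ∈ Ioo c d, HasDerivAt γ (v t) t := fun t ht ↦ by
    have hnt : Icc c d ∈ nhds t := Icc_mem_nhds ht.1 ht.2
    rw [hv, derivWithin_of_mem_nhds hnt]
    exact ((hγ.differentiableOn (by simp)).differentiableAt hnt).hasDerivAt
  obtain ⟨C, hC⟩ := isCompact_Icc.exists_bound_of_continuousOn hvc
  -- By compactness the piece stays in a closed ball of radius `‖γ t₁‖ < 1`, which serves as `r` in
  -- the differentiation lemma.
  obtain ⟨t₁, ht₁, hmax⟩ := isCompact_Icc.exists_isMaxOn (nonempty_Icc.2 hcd.le)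
    hγ.continuousOn.norm
  have hφc : ContinuousOn (fun t ↦ Real.sqrt (hessForm n a b (γ t) (v t))) (Icc c d) :=
    (continuousOn_hessForm_comp hn ha hb hγ.continuousOn hvc hball).sqrt
  have hφI : IntegrableOn (fun t ↦ Real.sqrt (hessForm n a b (γ t) (deriv γ t))) (Icc c d) := by
    -- `deriv γ` may take a default value at a corner. It agrees with the one-sided `v` inside the
    -- interval, and the endpoints have measure zero.
    rw [integrableOn_Icc_iff_integrableOn_Ioo]
    refine ((hφc.integrableOn_Icc).mono_set Ioo_subset_Icc_self).congr_fun (fun t ht ↦ ?_)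
      measurableSet_Ioo
    simp only
    rw [(hderiv t ht).deriv]
  refine ⟨(intervalIntegrable_iff_integrableOn_Icc_of_le hcd.le).2 hφI, ?_⟩
  refine norm_sub_le_integral_of_norm_deriv_le (g := fun t ↦ berezin n a b f (γ t)) hcd.le
    ((continuousOn_berezin hn ha hb (hf.memLp.integrable one_le_two)).comp hγ.continuousOn hball)
    (hφI.const_mul _) fun t ht ↦ ?_
  obtain ⟨D, hD, hDle⟩ := exists_hasDerivAt_berezin hn ha hb hf.memLp (s := Ioo c d)
    (isOpen_Ioo.mem_nhds ht) (mem_ball_zero_iff.1 (hball t₁ ht₁)) hderiv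
    (fun s hs ↦ hC s (Ioo_subset_Icc_self hs)) (fun s hs ↦ hmax (Ioo_subset_Icc_self hs))
  refine ⟨D, hD, hDle.trans ?_⟩
  rw [(hderiv t ht).deriv]
  have := meanOsc_le_bmoNorm hf (hball t (Ioo_subset_Icc_self ht))
  gcongr

/-- The Lipschitz estimate along a piecewise smooth curve. -/
theorem norm_berezin_sub_le_curveLength (hn : 1 ≤ n) (ha : -1 < a) (hb : -(n : ℝ) < b)
    {f : Cn n → ℂ} (hf : IsBMO n a b f) {z w : Cn n} {γ : ℝ → Cn n}
    (hγ : IsPiecewiseSmoothCurve z w γ) :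
    ‖berezin n a b f z - berezin n a b f w‖ ≤
      2 * bmoNorm n a b f * curveLength n a b γ := by
  obtain ⟨m, t, ht0, htm, hlt, hsm⟩ := hγ.piecewise
  have hmono : ∀ j ≤ m, ∀ i ≤ j, t i ≤ t j := fun j hj ↦ by
    induction j with
    | zero => intro i hi; rw [Nat.le_zero.1 hi]
    | succ j ih =>
      intro i hi
      rcases hi.eq_or_lt with rfl | hi
      · exact le_rfl
      · exact (ih (by omega) i (by omega)).trans (hlt j (by omega)).le
  have hpiece := fun i (hi : i < m) ↦ norm_berezin_sub_le_of_contDiffOn hn ha hb hf (hlt i hi)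
    (hsm i hi) fun s hs ↦ hγ.mem_ball s
      ⟨(ht0 ▸ hmono i hi.le 0 (Nat.zero_le _)).trans hs.1,
        hs.2.trans (htm ▸ hmono m le_rfl (i + 1) hi)⟩
  have hsum := intervalIntegral.sum_integral_adjacent_intervals (a := t) (n := m)
    fun i hi ↦ (hpiece i hi).1.const_mul (2 * bmoNorm n a b f)
  rw [curveLength, ← intervalIntegral.integral_const_mul, ← hγ.source, ← hγ.target, ← ht0, ← htm,
    ← hsum, ← dist_eq_norm]
  refine (dist_le_range_sum_dist (fun i ↦ berezin n a b f (γ (t i))) m).trans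
    (Finset.sum_le_sum fun i hi ↦ ?_)
  rw [dist_comm, dist_eq_norm]
  exact (hpiece i (Finset.mem_range.1 hi)).2

/-- The real infimum of the empty set is `0`, so the final bound needs at least one admissible
curve. -/
theorem isPiecewiseSmoothCurve_segment {z w : Cn n} (hz : z ∈ unitBall n) (hw : w ∈ unitBall n) :
    IsPiecewiseSmoothCurve z w fun t : ℝ ↦ z + t • (w - z) := by
  have hsm : ContDiff ℝ ∞ fun t : ℝ ↦ z + t • (w - z) := by fun_prop
  refine ⟨hsm.continuous.continuousOn, ⟨1, fun i ↦ i, by simp, by simp, fun i _ ↦ by simp,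
    fun i _ ↦ hsm.contDiffOn⟩, fun s hs ↦ ?_, by simp, by simp⟩
  exact (convex_ball (0 : Cn n) 1).add_smul_sub_mem hz hw hs

end BergmanBall

theorem theorem4p1 (n : ℕ) (hn : 1 ≤ n) (a b : ℝ) (ha : -1 < a) (hb : -(n : ℝ) < b)
    (f : BergmanBall.Cn n → ℂ) (hf : BergmanBall.IsBMO n a b f)
    (z w : BergmanBall.Cn n) (hz : z ∈ BergmanBall.unitBall n) (hw : w ∈ BergmanBall.unitBall n) :
    ‖BergmanBall.berezin n a b f z - BergmanBall.berezin n a b f w‖ ≤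
      2 * BergmanBall.bmoNorm n a b f * BergmanBall.bpDist n a b z w := by
  have hne : (BergmanBall.curveLength n a b ''
      {γ | BergmanBall.IsPiecewiseSmoothCurve z w γ}).Nonempty :=
    ⟨_, _, BergmanBall.isPiecewiseSmoothCurve_segment hz hw, rfl⟩
  have hM : 0 ≤ 2 * BergmanBall.bmoNorm n a b f :=
    mul_nonneg two_pos.le (BergmanBall.bmoNorm_nonneg n a b f)
  -- The nonnegative factor moves inside the infimum, leaving a lower bound to check curve by curve.
  rw [BergmanBall.bpDist, ← smul_eq_mul, ← Real.sInf_smul_of_nonneg hM]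
  refine le_csInf (hne.smul_set) ?_
  rintro _ ⟨_, ⟨γ, hγ, rfl⟩, rfl⟩
  exact BergmanBall.norm_berezin_sub_le_curveLength hn ha hb hf hγ
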